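/- Let $S^2=\mathbb{CP}^1$ carry the Fubini--Study (round, curvature one) metric, whose Laplacian in an affine coordinate $z$ is $$\triangle f=(1+|z|^2)^2\,\frac{\partial^2 f}{\partial z\,\partial\bar z}.$$ For a positive integer $k$ and a set $B\subset\mathbb{CP}^1$ of $2k-2$ points, let $K_{k,B}$ be the nonnegative function on $\mathbb{CP}^1$ that vanishes exactly at the points of $B$ and is given by $$K_{k,B}(x)=c\prod_{b\in B}d(x,b)^2,\qquad d([z:w],[z':w'])=\frac{|zw'-wz'|}{\sqrt{|z|^2+|w|^2}\,\sqrt{|z'|^2+|w'|^2}},$$ where $c>0$ is the constant for which the average of $K_{k,B}$ over $\mathbb{CP}^1$, with respect to Fubini--Study area, equals $k$. (Equivalently, $K_{k,B}=\|s\|^2$ for a holomorphic section $s$ of $\mathcal O(2k-2)$ with zero set $B$, scaled so that this average is $k$.) **Proposition.** There is a constant $C$ such that, for every sufficiently large integer $k$, there is a set $B_k\subset\mathbb{CP}^1$ of exactly $2k-2$ points, which is the set of branch points (critical points) of a rational map $p_k/q_k:\mathbb{CP}^1\to\mathbb{CP}^1$ of degree $k$, for which the equation $$\triangle v_k=k-K_k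 e^{2v_k},\qquad K_k=K_{k,B_k},$$ has a smooth solution $v_k:\mathbb{CP}^1\to\mathbb R$ on all of $\mathbb{CP}^1$ with $\|v_k\|_\infty\le C$. -/

import Mathlib

open scoped ContDiff LinearAlgebra.Projectivization

noncomputable section

namespace BranchPDE

/-- The sphere `S² = ℂℙ¹`. -/
abbrev CP1 : Type := ℙ ℂ (Fin 2 → ℂ)

/-- The affine coordinate `z ↦ [z : 1]`, a chart of `ℂℙ¹` around `[0 : 1]`. -/
def chartZ (z : ℂ) : CP1 :=
  Projectivization.mk ℂ ![z, 1] (fun h => one_ne_zero (congrFun h 1))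

/-- The affine coordinate `w ↦ [1 : w]`, a chart of `ℂℙ¹` around `[1 : 0]`. -/
def chartW (w : ℂ) : CP1 :=
  Projectivization.mk ℂ ![1, w] (fun h => one_ne_zero (congrFun h 0))

/-- A real function on `ℂℙ¹` is smooth if it is smooth in the two affine charts, which cover. -/
def Smooth (v : CP1 → ℝ) : Prop :=
  ContDiff ℝ ∞ (fun z => v (chartZ z)) ∧ ContDiff ℝ ∞ (fun w => v (chartW w))

/-- The Laplacian of the Fubini-Study metric, in either affine coordinate:
`(1 + |z|²)² ∂²f/∂z∂z̄`, and `∂²/∂z∂z̄` is one quarter of the Laplacian of the plane.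
It is the Laplace-Beltrami operator of the round metric `4 |dz|² / (1 + |z|²)²`. -/
def fsLaplacian (f : ℂ → ℝ) (z : ℂ) : ℝ :=
  (1 + ‖z‖ ^ 2) ^ 2 * (Laplacian.laplacian f z / 4)

/-- The average of a function over `ℂℙ¹` for the Fubini-Study area, which is
`dx dy / (1 + |z|²)²` up to a factor and then has total mass `π`. -/
def average (f : CP1 → ℝ) : ℝ :=
  (∫ z : ℂ, f (chartZ z) / (1 + ‖z‖ ^ 2) ^ 2) / Real.pi

/-- `|u₀ w₁ - u₁ w₀|² / (|u|² |w|²)` for two vectors of `ℂ²`. -/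
def chordSqAux (u w : Fin 2 → ℂ) : ℝ :=
  ‖u 0 * w 1 - u 1 * w 0‖ ^ 2 / ((‖u 0‖ ^ 2 + ‖u 1‖ ^ 2) * (‖w 0‖ ^ 2 + ‖w 1‖ ^ 2))

/-- The square of the chordal distance on `ℂℙ¹`, normalized to have maximum `1`
(a quarter of the squared distance in `ℝ³` between points of the unit sphere). -/
def chordSq (x y : CP1) : ℝ := chordSqAux x.rep y.rep

/-- The squared chordal distance can be computed from any homogeneous coordinates. -/
theorem chordSq_mk (u w : Fin 2 → ℂ) (hu : u ≠ 0) (hw : w ≠ 0) :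
    chordSq (Projectivization.mk ℂ u hu) (Projectivization.mk ℂ w hw) = chordSqAux u w := by
  obtain ⟨a, ha⟩ := Projectivization.exists_smul_eq_mk_rep ℂ u hu
  obtain ⟨b, hb⟩ := Projectivization.exists_smul_eq_mk_rep ℂ w hw
  unfold chordSq
  rw [← ha, ← hb]
  have ha0 : ‖(a : ℂ)‖ ≠ 0 := by simp
  have hb0 : ‖(b : ℂ)‖ ≠ 0 := by simp
  simp only [chordSqAux, Units.smul_def, Pi.smul_apply, smul_eq_mul]
  have h1 : (a : ℂ) * u 0 * (b * w 1) - a * u 1 * (b * w 0) =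
      a * b * (u 0 * w 1 - u 1 * w 0) := by ring
  rw [h1]
  simp only [norm_mul, mul_pow]
  rw [← mul_add, ← mul_add, mul_mul_mul_comm, mul_div_mul_left]
  positivity

/-- `∏ d(x, b)²` over the points `b` of `B`. For `B` with `2k - 2` points this is, up to a positive
factor, the squared pointwise norm of the holomorphic section of `O(2k - 2)` with zero set `B`. -/
def chordProd (B : Finset CP1) (x : CP1) : ℝ := ∏ b ∈ B, chordSq x b

/-- The function `K` determined by `k` and the points of `B`: the positive multiple of
`∏ d(x, b)²` whose average over `ℂℙ¹` is `k`. -/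
def curvatureFn (k : ℕ) (B : Finset CP1) (x : CP1) : ℝ :=
  k * chordProd B x / average (chordProd B)

/-- `v` is a smooth solution on all of `ℂℙ¹` of `Δ v = k - K e^{2v}`. -/
def IsSolution (k : ℕ) (K v : CP1 → ℝ) : Prop :=
  Smooth v ∧
  (∀ z : ℂ, fsLaplacian (fun ζ => v (chartZ ζ)) z =
    k - K (chartZ z) * Real.exp (2 * v (chartZ z))) ∧
  (∀ w : ℂ, fsLaplacian (fun ζ => v (chartW ζ)) w =
    k - K (chartW w) * Real.exp (2 * v (chartW w)))

/-- `B` is the set of branch points (critical points) of a rational map `p / q` of degree `k` from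
`ℂℙ¹` to itself. Here `p, q` are forms of degree `k` without common zeros on `ℂℙ¹`; at a point
with homogeneous coordinates `u`, the differential of `[p : q]` vanishes if and only if the
Jacobian determinant of `(p, q)` is zero at `u`, because `D(p, q)(u) u = k (p, q)(u) ≠ 0`. -/
def IsBranchSet (k : ℕ) (B : Finset CP1) : Prop :=
  ∃ p q : MvPolynomial (Fin 2) ℂ, p.IsHomogeneous k ∧ q.IsHomogeneous k ∧
    (∀ u : Fin 2 → ℂ, u ≠ 0 → MvPolynomial.eval u p ≠ 0 ∨ MvPolynomial.eval u q ≠ 0) ∧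
    ∀ (u : Fin 2 → ℂ) (hu : u ≠ 0), Projectivization.mk ℂ u hu ∈ B ↔
      MvPolynomial.eval u (MvPolynomial.pderiv 0 p * MvPolynomial.pderiv 1 q -
        MvPolynomial.pderiv 1 p * MvPolynomial.pderiv 0 q) = 0

end BranchPDE

end

namespace BranchPDE

open Polynomial Finset MeasureTheory Filter Topology InnerProductSpace

/-! A rational map `P/Q` of degree `k` gives an explicit solution. With `W` the Wronskian of `P` and
`Q`, one has `∂∂̄ log(|P|² + |Q|²) = |W|² / (|P|² + |Q|²)²` (`laplacian_log_sumSq`), so `v = c -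
log((|P|² + |Q|²) / (1 + |z|²)ᵏ)` solves an equation of the required shape. The function `K` there
is a multiple of `|W|² / (1 + |z|²)^(2k-2)`, that is, of the product of squared chordal distances to
the zeros of `W`, provided that these are `2k - 2` simple points. The constant `c` is then fixed by
the normalization of `K`.

A bound for `v` that is uniform in `k` therefore amounts to a pair with `|P|² + |Q|²` comparable to
`(1 + |z|²)ᵏ`, with constants independent of `k` (`exists_balanced_pair`). Each normalized monomial
`c_j zʲ` has relative size one near the circle `k|z|²/(1 + |z|²) = j` and Gaussian decay away from
it. For exponents spaced by a fixed number of standard deviations, only two consecutive terms `a`,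
`b` matter at any point, and at least one of them has relative size bounded below. Taking `P` with
all signs plus and `Q` with alternating signs gives approximately `a + b` and `±(a - b)`, which
cannot both be small.

Simple zeros of `W` are generic, so a small perturbation provides them without spoiling the bounds
(`exists_balanced_pair_separable`). Finally `c` is controlled because `|W|² / (|P|² + |Q|²)²` has an
integral depending only on `k` (`integral_wronskian`): the Laplacian of a function that extends
smoothly over infinity has integral zero. -/

/-! ### Peak weights of normalized monomials -/

/-- The weight `(y/j)^j ((k-y)/(k-j))^(k-j)`, which as a function of `y ∈ [0, k]` has its maximum,
equal to `1`, at `y = j`. -/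
noncomputable def peakWeight (k j : ℕ) (y : ℝ) : ℝ :=
  (y / j) ^ j * ((k - y) / (k - j : ℕ)) ^ (k - j)

theorem div_pow_le_exp (j : ℕ) {y : ℝ} (hy : 0 ≤ y) : (y / j) ^ j ≤ Real.exp (y - j) := by
  rcases Nat.eq_zero_or_pos j with rfl | hj
  · simpa using hy
  have hj' : (0 : ℝ) < j := by exact_mod_cast hj
  calc (y / j) ^ j ≤ Real.exp (y / j - 1) ^ j := by
        gcongr; linarith [Real.add_one_le_exp (y / j - 1)]
    _ = Real.exp (y - j) := by rw [← Real.exp_nat_mul]; congr 1; field_simp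

/-- This is `div_pow_le_exp` for the exponent `2j` at the point `2√(yj)`. Working with square roots
sharpens the linear exponent enough to give a Gaussian in `√y - √j`, once the other factor of the
weight is estimated linearly. -/
theorem div_pow_le_exp_sqrt (j : ℕ) {y : ℝ} (hy : 0 ≤ y) :
    (y / j) ^ j ≤ Real.exp (2 * √y * √j - 2 * j) := by
  have h := div_pow_le_exp (2 * j) (y := 2 * (√y * √j)) (by positivity)
  rcases Nat.eq_zero_or_pos j with rfl | hj
  · simp
  have hj' : (0 : ℝ) < j := by exact_mod_cast hj
  convert h using 1
  · rw [pow_mul]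
    congr 1
    have h1 : √(j : ℝ) ^ 2 = j := Real.sq_sqrt hj'.le
    have h2 : √y ^ 2 = y := Real.sq_sqrt hy
    push_cast
    field_simp
    rw [h1, h2]
  · push_cast; ring_nf

theorem exp_le_div_pow (j : ℕ) {y : ℝ} (hy : 0 < y) :
    Real.exp (j - j ^ 2 / y) ≤ (y / j) ^ j := by
  rcases Nat.eq_zero_or_pos j with rfl | hj
  · simp
  have hj' : (0 : ℝ) < j := by exact_mod_cast hj
  have h1 : Real.exp (1 - j / y) ≤ y / j := by
    have := Real.add_one_le_exp (j / y - 1)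
    rw [show (1 - j / y : ℝ) = -(j / y - 1) by ring, Real.exp_neg, inv_le_comm₀ (by positivity)
      (by positivity), inv_div]
    linarith
  calc Real.exp (j - j ^ 2 / y) = Real.exp (1 - j / y) ^ j := by
        rw [← Real.exp_nat_mul]; congr 1; field_simp
    _ ≤ _ := by gcongr

theorem peakWeight_nonneg {k j : ℕ} {y : ℝ} (h0 : 0 ≤ y) (hk : y ≤ k) : 0 ≤ peakWeight k j y := by
  have : 0 ≤ (k : ℝ) - y := by linarith
  unfold peakWeight; positivity

theorem peakWeight_le_exp_left {k j : ℕ} {y : ℝ} (hj : j ≤ k) (h0 : 0 ≤ y) (hk : y ≤ k) :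
    peakWeight k j y ≤ Real.exp (-(√y - √j) ^ 2) := by
  have hky : 0 ≤ (k : ℝ) - y := by linarith
  calc peakWeight k j y
      ≤ Real.exp (2 * √y * √j - 2 * j) * Real.exp ((k - y) - (k - j : ℕ)) := by
        unfold peakWeight
        gcongr
        · exact div_pow_le_exp_sqrt j h0
        · exact div_pow_le_exp _ hky
    _ = _ := by
        rw [← Real.exp_add, Nat.cast_sub hj]
        congr 1
        have h1 : √(j : ℝ) ^ 2 = j := Real.sq_sqrt (by positivity)
        have h2 : √y ^ 2 = y := Real.sq_sqrt h0
        linear_combination h1 + h2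

theorem peakWeight_symm {k j : ℕ} (hj : j ≤ k) (y : ℝ) :
    peakWeight k (k - j) (k - y) = peakWeight k j y := by
  unfold peakWeight
  rw [Nat.sub_sub_self hj, sub_sub_cancel, mul_comm]

theorem peakWeight_le_exp_right {k j : ℕ} {y : ℝ} (hj : j ≤ k) (h0 : 0 ≤ y) (hk : y ≤ k) :
    peakWeight k j y ≤ Real.exp (-(√(k - y) - √(k - j : ℕ)) ^ 2) := by
  rw [← peakWeight_symm hj]
  exact peakWeight_le_exp_left (Nat.sub_le _ _) (by linarith) (by linarith)

theorem peakWeight_le_one {k j : ℕ} {y : ℝ} (hj : j ≤ k) (h0 : 0 ≤ y) (hk : y ≤ k) :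
    peakWeight k j y ≤ 1 :=
  (peakWeight_le_exp_left hj h0 hk).trans (Real.exp_le_one_iff.2 (by simpa using sq_nonneg _))

theorem exp_le_peakWeight {k j : ℕ} {y C : ℝ} (hj : j ≤ k) (h0 : 0 ≤ y) (hk : y < k)
    (hC0 : 0 ≤ C) (hC : (y - j) ^ 2 * k ≤ C * (y * (k - y))) :
    Real.exp (-C) ≤ peakWeight k j y := by
  have hky : 0 < (k : ℝ) - y := by linarith
  rcases h0.eq_or_lt with rfl | h0
  · have hj0 : j = 0 := by
      have : (j : ℝ) ^ 2 * k ≤ 0 := by simpa using hC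
      have h2 : (0 : ℝ) < k := hk
      have : (j : ℝ) ^ 2 ≤ 0 := by
        by_contra! h
        linarith [mul_pos h h2]
      have := pow_eq_zero_iff (two_ne_zero) |>.1 (le_antisymm this (sq_nonneg _))
      exact_mod_cast this
    subst hj0
    have : (k : ℝ) ≠ 0 := by linarith
    simp [peakWeight, this, hC0]
  calc Real.exp (-C) ≤ Real.exp (j - j ^ 2 / y) *
        Real.exp ((k - j : ℕ) - (k - j : ℕ) ^ 2 / (k - y)) := by
        rw [← Real.exp_add, Nat.cast_sub hj, Real.exp_le_exp]
        -- The linear terms of the two exponents cancel, leaving the squared distance to the peak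
        -- divided by the variance `y(k - y)/k`.
        have : (j : ℝ) - j ^ 2 / y + (k - j - (k - j) ^ 2 / (k - y)) =
            - ((y - j) ^ 2 * k / (y * (k - y))) := by
          field_simp
          ring
        rw [this, neg_le_neg_iff, div_le_iff₀ (by positivity)]
        exact hC
    _ ≤ _ := by
        unfold peakWeight
        gcongr
        · exact exp_le_div_pow j h0
        · exact exp_le_div_pow _ hky

/-- The ratio of the weights of `i` and `j` is a constant times `(y/(k - y))^(i-j)`, hence
increasing in `y`. Left of `j` it is at most its value at `j`, where the weight of `j` equals one.
-/
theorem peakWeight_le_mul_of_lt {k i j : ℕ} {y : ℝ} (hji : j < i) (hi : i ≤ k) (h0 : 0 ≤ y)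
    (hy : y ≤ j) : peakWeight k i y ≤ peakWeight k j y * peakWeight k i j := by
  obtain ⟨d, rfl⟩ := Nat.exists_eq_add_of_lt hji
  obtain ⟨e, rfl⟩ := Nat.exists_eq_add_of_le hi
  have e1 : j + d + 1 + e - j = d + 1 + e := by omega
  have e2 : j + d + 1 + e - (j + d + 1) = e := by omega
  unfold peakWeight
  rw [e1, e2]
  push_cast
  set J : ℝ := (j : ℝ)
  set A : ℝ := (j : ℝ) + d + 1
  set D : ℝ := (d : ℝ) + 1 + e with hD
  have hA : (0 : ℝ) < A := by positivity
  have hDp : (0 : ℝ) < D := by positivity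
  have hk : J + d + 1 + e - y = D + J - y := by rw [hD]; ring
  have hk' : J + d + 1 + e - J = D := by rw [hD]; ring
  rw [hk, hk']
  have hJ : (0 : ℝ) ≤ J := Nat.cast_nonneg j
  have hDy : 0 ≤ D + J - y := by linarith
  -- Here `D = k - j`, so this is `y/(k - y) ≤ j/(k - j)` with denominators cleared. It enters below
  -- with the power `d + 1 = i - j`.
  have key : y * D ≤ (D + J - y) * J := by nlinarith
  have hjj : J ^ j ≠ 0 := by
    rcases Nat.eq_zero_or_pos j with h | h
    · simp [J, h]
    · exact (pow_pos (Nat.cast_pos.2 h) j).ne'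
  have hee : (e : ℝ) ^ e ≠ 0 := by
    rcases Nat.eq_zero_or_pos e with h | h
    · simp [h]
    · positivity
  have hee' : (0 : ℝ) < (e : ℝ) ^ e := lt_of_le_of_ne (by positivity) (Ne.symm hee)
  have expand : (y / J) ^ j * ((D + J - y) / D) ^ (d + 1 + e) *
      ((J / A) ^ (j + d + 1) * (D / e) ^ e) =
      y ^ j * (D + J - y) ^ e * ((D + J - y) * J) ^ (d + 1) /
        (A ^ (j + d + 1) * e ^ e * D ^ (d + 1)) := by
    rw [div_pow, div_pow, div_pow, div_pow, mul_pow _ J]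
    field_simp
    ring
  have expand2 : (y / A) ^ (j + d + 1) * ((D + J - y) / e) ^ e =
      y ^ j * (D + J - y) ^ e * (y * D) ^ (d + 1) /
        (A ^ (j + d + 1) * e ^ e * D ^ (d + 1)) := by
    rw [div_pow, div_pow]
    field_simp
    ring_nf
  rw [expand, expand2]
  gcongr

theorem peakWeight_le_mul_of_gt {k i j : ℕ} {y : ℝ} (hij : i < j) (hj : j ≤ k) (hk : y ≤ k)
    (hy : j ≤ y) : peakWeight k i y ≤ peakWeight k j y * peakWeight k i j := by
  have hi : i ≤ k := hij.le.trans hj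
  rw [← peakWeight_symm hi, ← peakWeight_symm hj, ← peakWeight_symm hi (j : ℝ),
    ← Nat.cast_sub hj]
  exact peakWeight_le_mul_of_lt (by omega) (Nat.sub_le _ _) (by linarith)
    (by rw [Nat.cast_sub hj]; linarith)

/-! ### Lacunary exponents and dominant terms -/

theorem exp_neg_four_le : Real.exp (-4) ≤ 1 / 16 := by
  have h := Real.add_one_le_exp (1 : ℝ)
  rw [Real.exp_neg, inv_le_comm₀ (Real.exp_pos _) (by norm_num)]
  calc ((1 : ℝ) / 16)⁻¹ = (1 + 1) ^ 4 := by norm_num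
    _ ≤ Real.exp 1 ^ 4 := by gcongr
    _ = Real.exp 4 := by rw [← Real.exp_nat_mul]; norm_num

/-- Two exponents are far apart if the weight of either is small at the peak of the other. -/
def FarApart (k i j : ℕ) : Prop :=
  √(i : ℝ) + 2 ≤ √(j : ℝ) ∨ √((k - j : ℕ) : ℝ) + 2 ≤ √((k - i : ℕ) : ℝ)

theorem FarApart.peakWeight_le {k i j : ℕ} (hi : i ≤ k) (hj : j ≤ k) (h : FarApart k i j) :
    peakWeight k i j ≤ 1 / 16 ∧ peakWeight k j i ≤ 1 / 16 := by
  have hi' : (i : ℝ) ≤ k := by exact_mod_cast hi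
  have hj' : (j : ℝ) ≤ k := by exact_mod_cast hj
  have key : ∀ a b : ℝ, a + 2 ≤ b → Real.exp (-(b - a) ^ 2) ≤ 1 / 16 ∧
      Real.exp (-(a - b) ^ 2) ≤ 1 / 16 := fun a b hab =>
    ⟨(Real.exp_le_exp.2 (by nlinarith)).trans exp_neg_four_le,
      (Real.exp_le_exp.2 (by nlinarith)).trans exp_neg_four_le⟩
  rcases h with h | h
  · exact ⟨(peakWeight_le_exp_left hi (by positivity) hj').trans (key _ _ h).1,
      (peakWeight_le_exp_left hj (by positivity) hi').trans (key _ _ h).2⟩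
  · have h1 := peakWeight_le_exp_right hi (y := j) (by positivity) hj'
    have h2 := peakWeight_le_exp_right hj (y := i) (by positivity) hi'
    rw [← Nat.cast_sub hj] at h1
    rw [← Nat.cast_sub hi] at h2
    exact ⟨h1.trans (key _ _ h).2, h2.trans (key _ _ h).1⟩

/-- The factor `1/3` is `∑ 4⁻ᵐ` over `m ≥ 1`. The ratio `4` for norms is the square root of the
ratio `16` for weights. -/
theorem sum_range_le_of_geometric {a : ℕ → ℝ} {l : ℕ} (h0 : ∀ m, 0 ≤ a m)
    (h : ∀ m < l, 4 * a m ≤ a (m + 1)) : ∑ m ∈ range l, a m ≤ a l / 3 := by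
  induction l with
  | zero => simpa using div_nonneg (h0 0) (by norm_num)
  | succ l ih =>
    rw [sum_range_succ]
    linarith [ih fun m hm => h m (by omega), h l (by omega)]

theorem sum_Ico_le_of_geometric {a : ℕ → ℝ} {l n : ℕ} (hln : l ≤ n)
    (h : ∀ m, l ≤ m → m < n → 4 * a (m + 1) ≤ a m) :
    ∑ m ∈ Ico (l + 1) (n + 1), a m ≤ a l / 3 - a n / 3 := by
  induction n, hln using Nat.le_induction with
  | base => simp
  | succ n hln ih =>
    rw [sum_Ico_succ_top (by omega)]
    linarith [ih fun m h1 h2 => h m h1 (by omega), h n hln (by omega)]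

/-- A sum whose terms decrease geometrically away from two consecutive ones is close to the sum of
these two. -/
theorem norm_sum_sub_le_of_geometric {a : ℕ → ℂ} {l n : ℕ} (hln : l < n)
    (hd : ∀ m < l, 4 * ‖a m‖ ≤ ‖a (m + 1)‖)
    (hu : ∀ m, l + 1 ≤ m → m < n → 4 * ‖a (m + 1)‖ ≤ ‖a m‖) :
    ‖∑ m ∈ range (n + 1), a m - (a l + a (l + 1))‖ ≤ (‖a l‖ + ‖a (l + 1)‖) / 3 := by
  have h1 := sum_range_le_of_geometric (a := fun m => ‖a m‖) (fun _ => norm_nonneg _) hd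
  have h2 := sum_Ico_le_of_geometric (a := fun m => ‖a m‖) (l := l + 1) (n := n) (by omega) hu
  have e : ∑ m ∈ range (n + 1), a m - (a l + a (l + 1)) =
      ∑ m ∈ range l, a m + ∑ m ∈ Ico (l + 1 + 1) (n + 1), a m := by
    rw [← sum_range_add_sum_Ico a (show l + 2 ≤ n + 1 by omega), sum_range_succ, sum_range_succ]
    ring
  rw [e]
  have h3 := norm_sum_le (range l) a
  have h4 := norm_sum_le (Ico (l + 1 + 1) (n + 1)) a
  have h5 := norm_add_le (∑ m ∈ range l, a m) (∑ m ∈ Ico (l + 1 + 1) (n + 1), a m)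
  have h6 := norm_nonneg (a n)
  linarith

theorem sq_sub_mul_le_of_le_half {k y a : ℝ} (hy0 : 0 ≤ y) (hy : 2 * y ≤ k)
    (h : (y - a) ^ 2 ≤ 121 * y) : (y - a) ^ 2 * k ≤ 242 * (y * (k - y)) := by
  have hk : 0 ≤ k := by linarith
  nlinarith [mul_le_mul_of_nonneg_right h hk, mul_nonneg hy0 (sub_nonneg.2 hy)]

/-- The constant `121` has room to spare here. It is dictated by the wider middle gap in
`exists_exponents`. -/
theorem sq_sub_four_mul_sq_le (i : ℕ) {y : ℝ} (h1 : 4 * (i : ℝ) ^ 2 ≤ y)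
    (h2 : y ≤ 4 * ((i : ℝ) + 1) ^ 2) : (y - 4 * (i : ℝ) ^ 2) ^ 2 ≤ 121 * y := by
  have h4 : y - 4 * (i : ℝ) ^ 2 ≤ 8 * i + 4 := by linarith
  have h3 : (y - 4 * (i : ℝ) ^ 2) ^ 2 ≤ (8 * i + 4) ^ 2 :=
    pow_le_pow_left₀ (by linarith) h4 2
  rcases Nat.eq_zero_or_pos i with rfl | hi
  · simp only [CharP.cast_eq_zero] at *
    nlinarith
  · have : (1 : ℝ) ≤ i := by exact_mod_cast hi
    nlinarith

/-- The lower bound makes `√(k - 4M²) ≥ 2M + 2`, so that `4M²` and its mirror image `k - 4M²` are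
still far apart. Maximality of `M` keeps the gap between them short. -/
theorem exists_middle_index {k : ℕ} (hk : 4 ≤ k) :
    ∃ M : ℕ, 4 * M ^ 2 + 4 * (M + 1) ^ 2 ≤ k ∧ k < 4 * (M + 1) ^ 2 + 4 * (M + 2) ^ 2 := by
  have hex : ∃ M : ℕ, k < 4 * (M + 1) ^ 2 + 4 * (M + 2) ^ 2 := ⟨k, by nlinarith⟩
  refine ⟨Nat.find hex, ?_, Nat.find_spec hex⟩
  rcases h : Nat.find hex with _ | m
  · simpa using hk
  · simpa [add_assoc] using Nat.find_min hex (m := m) (by omega)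

theorem sqrt_four_mul_sq (i : ℕ) : √((4 * i ^ 2 : ℕ) : ℝ) = 2 * i := by
  rw [show ((4 * i ^ 2 : ℕ) : ℝ) = (2 * (i : ℝ)) ^ 2 by push_cast; ring,
    Real.sqrt_sq (by positivity)]

/-- Exponents, with gaps of order `√(j (k - j) / k)` near `j`, which are pairwise far apart but
close enough for the peaks of their weights to cover `[0, k]`. -/
theorem exists_exponents {k : ℕ} (hk : 4 ≤ k) :
    ∃ (n : ℕ) (J : ℕ → ℕ), J 0 = 0 ∧ J n = k ∧ ∀ m < n, J m < J (m + 1) ∧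
      FarApart k (J m) (J (m + 1)) ∧ ∀ y : ℝ, J m ≤ y → y ≤ J (m + 1) →
        ((y - J m) ^ 2 * k ≤ 242 * (y * (k - y)) ∨
          (y - J (m + 1)) ^ 2 * k ≤ 242 * (y * (k - y))) := by
  obtain ⟨M, hM1, hM2⟩ := exists_middle_index hk
  have hM1' : 4 * (M : ℝ) ^ 2 + 4 * (M + 1) ^ 2 ≤ k := by exact_mod_cast hM1
  have hM2' : (k : ℝ) ≤ 4 * (M + 1) ^ 2 + 4 * (M + 2) ^ 2 := by exact_mod_cast hM2.le
  -- The square roots of the exponents `4m²` advance by exactly `2`. The second half is the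
  -- reflection `j ↦ k - j` of the first, and the step from `M` to `M + 1` crosses the middle.
  refine ⟨2 * M + 1, fun m => if m ≤ M then 4 * m ^ 2 else k - 4 * (2 * M + 1 - m) ^ 2,
    by simp, by simp [show ¬ 2 * M + 1 ≤ M by omega], fun m hm => ?_⟩
  have hMM : (M : ℝ) ^ 2 ≤ (M + 1) ^ 2 := by gcongr; linarith
  have hsmall : ∀ i < M, 4 * (i + 1) ^ 2 ≤ 4 * M ^ 2 := fun i hi =>
    Nat.mul_le_mul_left 4 (Nat.pow_le_pow_left hi 2)
  rcases lt_trichotomy m M with h | rfl | h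
  · have h1 := hsmall m h
    have h1' : 4 * ((m : ℝ) + 1) ^ 2 ≤ 4 * M ^ 2 := by exact_mod_cast h1
    simp only [h.le, if_true, show m + 1 ≤ M from h]
    refine ⟨by nlinarith, Or.inl ?_, fun y hy1 hy2 => Or.inl ?_⟩
    · rw [sqrt_four_mul_sq, sqrt_four_mul_sq]; push_cast; linarith
    · push_cast at hy1 hy2 ⊢
      refine sq_sub_mul_le_of_le_half (le_trans (by positivity) hy1) ?_
        (sq_sub_four_mul_sq_le m hy1 hy2)
      linarith
  · simp only [le_refl, if_true, show ¬ (m + 1 ≤ m) by omega, if_false,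
      show 2 * m + 1 - (m + 1) = m by omega]
    have hle : 4 * m ^ 2 ≤ k := by nlinarith
    refine ⟨by rw [Nat.lt_sub_iff_add_lt]; nlinarith, Or.inl ?_, fun y hy1 hy2 => ?_⟩
    · rw [sqrt_four_mul_sq, Nat.cast_sub hle]
      apply Real.le_sqrt_of_sq_le
      push_cast
      linarith
    · rw [Nat.cast_sub hle] at hy2 ⊢
      push_cast at hy1 hy2 ⊢
      have gap : ∀ x : ℝ, 4 * (m : ℝ) ^ 2 ≤ x → 2 * x ≤ k →
          (x - 4 * (m : ℝ) ^ 2) ^ 2 ≤ 121 * x := by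
        intro x hx1 hx2
        -- From `x ≤ k/2 ≤ 2(m + 1)² + 2(m + 2)²`. Then `(12m + 10)² ≤ 121 · 4m²` for `m ≥ 1`, with
        -- equality at `m = 1`.
        have h4 : x - 4 * (m : ℝ) ^ 2 ≤ 12 * m + 10 := by linarith
        have h3 : (x - 4 * (m : ℝ) ^ 2) ^ 2 ≤ (12 * m + 10) ^ 2 :=
          pow_le_pow_left₀ (by linarith) h4 2
        rcases Nat.eq_zero_or_pos m with rfl | hi
        · simp only [CharP.cast_eq_zero] at *
          nlinarith
        · have : (1 : ℝ) ≤ m := by exact_mod_cast hi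
          nlinarith
      rcases le_total (2 * y) k with hy | hy
      · exact Or.inl (sq_sub_mul_le_of_le_half (le_trans (by positivity) hy1) hy (gap y hy1 hy))
      · right
        have h5 := sq_sub_mul_le_of_le_half (k := k) (y := k - y) (a := 4 * (m : ℝ) ^ 2)
          (le_trans (by positivity) (show 4 * (m : ℝ) ^ 2 ≤ k - y by linarith)) (by linarith)
          (gap (k - y) (by linarith) (by linarith))
        convert h5 using 1 <;> ring
  · obtain ⟨i, hi, hiM⟩ : ∃ i, m + i = 2 * M ∧ i < M := ⟨2 * M - m, by omega, by omega⟩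
    have h1 := hsmall i hiM
    have h1' : 4 * ((i : ℝ) + 1) ^ 2 ≤ 4 * M ^ 2 := by exact_mod_cast h1
    simp only [show ¬ m ≤ M by omega, show ¬ m + 1 ≤ M by omega, if_false,
      show 2 * M + 1 - (m + 1) = i by omega, show 2 * M + 1 - m = i + 1 by omega]
    have hle : 4 * (i + 1) ^ 2 ≤ k := by nlinarith
    have hle' : 4 * i ^ 2 ≤ k := by nlinarith
    refine ⟨by apply Nat.sub_lt_sub_left <;> nlinarith, Or.inr ?_, fun y hy1 hy2 => Or.inr ?_⟩
    · rw [Nat.sub_sub_self hle, Nat.sub_sub_self hle', sqrt_four_mul_sq, sqrt_four_mul_sq]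
      push_cast; linarith
    · rw [Nat.cast_sub hle] at hy1
      rw [Nat.cast_sub hle'] at hy2 ⊢
      push_cast at hy1 hy2 ⊢
      have h5 := sq_sub_mul_le_of_le_half (k := k) (y := k - y) (a := 4 * (i : ℝ) ^ 2)
          (le_trans (by positivity) (show 4 * (i : ℝ) ^ 2 ≤ k - y by linarith)) (by linarith)
          (sq_sub_four_mul_sq_le i (by linarith) (by linarith))
      convert h5 using 1 <;> ring

/-! ### The balanced pair -/

/-- The coefficient for which `|c zʲ|² / (1 + |z|²)ᵏ` has maximum `1`. -/
noncomputable def peakCoeff (k j : ℕ) : ℝ := √((k : ℝ) ^ k / (j ^ j * (k - j : ℕ) ^ (k - j)))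

theorem sq_norm_peakCoeff_mul_pow {k j : ℕ} (hj : j ≤ k) (z : ℂ) :
    ‖(peakCoeff k j : ℂ) * z ^ j‖ ^ 2 =
      (1 + ‖z‖ ^ 2) ^ k * peakWeight k j (k * ‖z‖ ^ 2 / (1 + ‖z‖ ^ 2)) := by
  have hk : (k : ℝ) - k * ‖z‖ ^ 2 / (1 + ‖z‖ ^ 2) = k / (1 + ‖z‖ ^ 2) := by
    field_simp; ring
  rw [norm_mul, mul_pow, Complex.norm_real, Real.norm_eq_abs, sq_abs, peakCoeff,
    Real.sq_sqrt (by positivity), peakWeight, hk, norm_pow]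
  obtain ⟨e, rfl⟩ := Nat.exists_eq_add_of_le hj
  rw [Nat.add_sub_cancel_left]
  simp only [div_pow, mul_pow, pow_add]
  field_simp
  ring

theorem peakWeight_ratio_up {k i j : ℕ} {y : ℝ} (hij : i < j) (hj : j ≤ k) (h : FarApart k i j)
    (h0 : 0 ≤ y) (hy : y ≤ i) : 16 * peakWeight k j y ≤ peakWeight k i y := by
  have hik : (i : ℝ) ≤ k := by exact_mod_cast hij.le.trans hj
  have h1 := peakWeight_le_mul_of_lt hij hj h0 hy
  have h2 := mul_le_mul_of_nonneg_left (h.peakWeight_le (hij.le.trans hj) hj).2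
    (peakWeight_nonneg (j := i) h0 (hy.trans hik))
  linarith

theorem peakWeight_ratio_down {k i j : ℕ} {y : ℝ} (hij : i < j) (hj : j ≤ k) (h : FarApart k i j)
    (hk : y ≤ k) (hy : j ≤ y) : 16 * peakWeight k i y ≤ peakWeight k j y := by
  have h1 := peakWeight_le_mul_of_gt hij hj hk hy
  have h2 := mul_le_mul_of_nonneg_left (h.peakWeight_le (hij.le.trans hj) hj).1
    (peakWeight_nonneg (j := j) ((Nat.cast_nonneg j).trans hy) hk)
  linarith

/-- Since `2a` and `2b` are the sum and difference of `a + b` and `a - b`, one has `‖a + b‖ + ‖a -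
b‖ ≥ 2 max(‖a‖, ‖b‖)`. The two errors together cost at most `4/3` of the maximum, so a definite
fraction survives. -/
theorem bounds_of_near {a b S T : ℂ} (hS : ‖S - (a + b)‖ ≤ (‖a‖ + ‖b‖) / 3)
    (hT : ‖T - (a - b)‖ ≤ (‖a‖ + ‖b‖) / 3 ∨ ‖T + (a - b)‖ ≤ (‖a‖ + ‖b‖) / 3) :
    (max ‖a‖ ‖b‖) ^ 2 / 8 ≤ ‖S‖ ^ 2 + ‖T‖ ^ 2 ∧ ‖S‖ ^ 2 + ‖T‖ ^ 2 ≤ 16 * (max ‖a‖ ‖b‖) ^ 2 := by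
  set m := max ‖a‖ ‖b‖
  have ham : ‖a‖ ≤ m := le_max_left _ _
  have hbm : ‖b‖ ≤ m := le_max_right _ _
  have ha := norm_nonneg a
  have hb := norm_nonneg b
  have hs0 := norm_nonneg S
  have ht0 := norm_nonneg T
  have h1 := norm_add_le (a + b) (a - b)
  have h2 := norm_sub_le (a + b) (a - b)
  rw [show a + b + (a - b) = 2 * a by ring, norm_mul] at h1
  rw [show a + b - (a - b) = 2 * b by ring, norm_mul] at h2
  have h3 := norm_sub_norm_le (a + b) S
  have h3' := norm_sub_norm_le S (a + b)
  have h4 := norm_add_le a b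
  have h5 := norm_sub_le a b
  rw [norm_sub_rev] at h3
  simp only [RCLike.norm_ofNat] at h1 h2
  have hT1 : ‖a - b‖ - ‖T‖ ≤ (‖a‖ + ‖b‖) / 3 ∧ ‖T‖ - ‖a - b‖ ≤ (‖a‖ + ‖b‖) / 3 := by
    rcases hT with hT | hT
    · exact ⟨(norm_sub_norm_le _ _).trans (by rwa [norm_sub_rev]),
        (norm_sub_norm_le _ _).trans hT⟩
    · rw [← sub_neg_eq_add] at hT
      constructor
      · rw [← norm_neg (a - b)]
        exact (norm_sub_norm_le _ _).trans (by rwa [norm_sub_rev])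
      · rw [← norm_neg (a - b)]
        exact (norm_sub_norm_le _ _).trans hT
  have hm : m ≤ ‖a‖ ∨ m ≤ ‖b‖ := by
    rcases le_total ‖a‖ ‖b‖ with h | h
    · right; exact (max_eq_right h).le
    · left; exact (max_eq_left h).le
  have hm0 : 0 ≤ m := ha.trans ham
  have hlow : 2 / 3 * m ≤ ‖S‖ + ‖T‖ := by
    rcases hm with h | h <;> linarith [hT1.1]
  have hup : ‖S‖ ≤ 8 / 3 * m := by linarith
  have hup' : ‖T‖ ≤ 8 / 3 * m := by linarith [hT1.2]
  constructor
  · nlinarith [sq_nonneg (‖S‖ - ‖T‖)]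
  · nlinarith

theorem exists_mem_interval {n : ℕ} {J : ℕ → ℕ} {y : ℝ} (h0 : J 0 ≤ y) (hn : y < J n) :
    ∃ l < n, J l ≤ y ∧ y < J (l + 1) := by
  induction n with
  | zero => exact absurd h0 (not_le.2 hn)
  | succ n ih =>
    rcases le_or_gt (J n : ℝ) y with h | h
    · exact ⟨n, by omega, h, hn⟩
    · obtain ⟨l, hl, h1⟩ := ih h
      exact ⟨l, by omega, h1⟩

/-- There are polynomials `P, Q` of degree `k` with `|P|² + |Q|²` comparable to `(1 + |z|²)ᵏ`,
uniformly in `k`. They are lacunary sums of monomials normalized to have norm one. -/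
theorem exists_balanced_pair : ∃ M₁ M₂ : ℝ, 0 < M₁ ∧ ∀ k : ℕ, 4 ≤ k →
    ∃ P Q : ℂ[X], P.natDegree ≤ k ∧ Q.natDegree ≤ k ∧ ∀ z : ℂ,
      M₁ * (1 + ‖z‖ ^ 2) ^ k ≤ ‖P.eval z‖ ^ 2 + ‖Q.eval z‖ ^ 2 ∧
      ‖P.eval z‖ ^ 2 + ‖Q.eval z‖ ^ 2 ≤ M₂ * (1 + ‖z‖ ^ 2) ^ k := by
  refine ⟨Real.exp (-242) / 8, 16, by positivity, fun k hk => ?_⟩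
  obtain ⟨n, J, hJ0, hJn, hJ⟩ := exists_exponents hk
  have hmono : ∀ m ≤ n, ∀ l ≤ m, J l ≤ J m := by
    intro m hm l hl
    induction m, hl using Nat.le_induction with
    | base => exact le_rfl
    | succ m _ ih => exact (ih (by omega)).trans (hJ m (by omega)).1.le
  have hJk : ∀ m ≤ n, J m ≤ k := fun m hm => hJn ▸ hmono n le_rfl m hm
  let S : ℂ → ℂ[X] := fun ε => ∑ m ∈ range (n + 1), C (ε ^ m * peakCoeff k (J m)) * X ^ J m
  have hdeg : ∀ ε, (S ε).natDegree ≤ k := fun ε => natDegree_sum_le_of_forall_le _ _ fun m hm =>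
    (natDegree_C_mul_X_pow_le _ _).trans (hJk m (by simp at hm; omega))
  -- The same terms with constant and with alternating signs.
  refine ⟨S 1, S (-1), hdeg _, hdeg _, fun z => ?_⟩
  set y : ℝ := k * ‖z‖ ^ 2 / (1 + ‖z‖ ^ 2) with hy
  have hk0 : (0 : ℝ) < k := by positivity
  have hy0 : 0 ≤ y := by positivity
  have hyk : y < k := by
    rw [hy, div_lt_iff₀ (by positivity)]; nlinarith
  set D : ℝ := (1 + ‖z‖ ^ 2) ^ k
  have hD : 0 < D := by positivity
  let a : ℕ → ℂ := fun m => peakCoeff k (J m) * z ^ J m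
  have ha : ∀ m ≤ n, ‖a m‖ ^ 2 = D * peakWeight k (J m) y := fun m hm =>
    sq_norm_peakCoeff_mul_pow (hJk m hm) z
  have hS : ∀ ε, (S ε).eval z = ∑ m ∈ range (n + 1), ε ^ m * a m := fun ε => by
    simp [S, a, eval_finsetSum, mul_assoc]
  obtain ⟨l, hln, hly, hyl⟩ := exists_mem_interval (J := J) (y := y) (n := n) (by simpa [hJ0])
    (by simpa [hJn])
  have hd : ∀ m < l, 4 * ‖a m‖ ≤ ‖a (m + 1)‖ := by
    intro m hm
    have h1 := peakWeight_ratio_down (y := y) (hJ m (by omega)).1 (hJk _ (by omega))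
      (hJ m (by omega)).2.1 hyk.le
      (le_trans (by exact_mod_cast hmono l (by omega) (m + 1) (by omega)) hly)
    refine le_of_sq_le_sq ?_ (norm_nonneg _)
    rw [mul_pow, ha m (by omega), ha (m + 1) (by omega)]
    nlinarith
  have hu : ∀ m, l + 1 ≤ m → m < n → 4 * ‖a (m + 1)‖ ≤ ‖a m‖ := by
    intro m hlm hm
    have h1 := peakWeight_ratio_up (y := y) (hJ m (by omega)).1 (hJk _ (by omega))
      (hJ m (by omega)).2.1 hy0
      (le_trans hyl.le (by exact_mod_cast hmono m (by omega) (l + 1) (by omega)))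
    refine le_of_sq_le_sq ?_ (norm_nonneg _)
    rw [mul_pow, ha m (by omega), ha (m + 1) (by omega)]
    nlinarith
  have near : ∀ ε : ℂ, ‖ε‖ = 1 → ‖(S ε).eval z - (ε ^ l * a l + ε ^ (l + 1) * a (l + 1))‖ ≤
      (‖a l‖ + ‖a (l + 1)‖) / 3 := by
    intro ε hε
    have h := norm_sum_sub_le_of_geometric (a := fun m => ε ^ m * a m) hln (by simpa [hε] using hd)
      (by simpa [hε] using hu)
    simpa [hε, ← hS] using h
  have h1 := near 1 (by simp)
  have h2 := near (-1) (by simp)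
  obtain ⟨hlow, hup⟩ := bounds_of_near (a := a l) (b := a (l + 1)) (S := (S 1).eval z)
    (T := (S (-1)).eval z) (by simpa using h1) (by
      -- The two dominant terms of `S (-1)` are `a l - a (l + 1)` up to the sign `(-1)ˡ`.
      rcases neg_one_pow_eq_or ℂ l with h | h
      · left; convert h2 using 3; rw [pow_succ, h]; ring
      · right; rw [← sub_neg_eq_add]; convert h2 using 3; rw [pow_succ, h]; ring)
  have hmax : (max ‖a l‖ ‖a (l + 1)‖) ^ 2 = D * max (peakWeight k (J l) y)
      (peakWeight k (J (l + 1)) y) := by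
    rw [mul_max_of_nonneg _ _ hD.le, ← ha l (by omega), ← ha (l + 1) (by omega)]
    rcases le_total ‖a l‖ ‖a (l + 1)‖ with h | h
    · rw [max_eq_right h, max_eq_right (pow_le_pow_left₀ (norm_nonneg _) h 2)]
    · rw [max_eq_left h, max_eq_left (pow_le_pow_left₀ (norm_nonneg _) h 2)]
  have hw1 : max (peakWeight k (J l) y) (peakWeight k (J (l + 1)) y) ≤ 1 :=
    max_le (peakWeight_le_one (hJk _ (by omega)) hy0 hyk.le)
      (peakWeight_le_one (hJk _ (by omega)) hy0 hyk.le)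
  have hw2 : Real.exp (-242) ≤ max (peakWeight k (J l) y) (peakWeight k (J (l + 1)) y) := by
    rcases (hJ l hln).2.2 y hly hyl.le with h | h
    · exact le_max_of_le_left (exp_le_peakWeight (hJk _ (by omega)) hy0 hyk (by norm_num) h)
    · exact le_max_of_le_right (exp_le_peakWeight (hJk _ (by omega)) hy0 hyk (by norm_num) h)
  rw [hmax] at hlow hup
  constructor
  · refine le_trans ?_ hlow
    nlinarith
  · refine hup.trans ?_
    nlinarith

/-! ### Wronskians: degree and generic separability -/

theorem natDegree_wronskian_le_of_le {R : Type*} [CommRing R] {a b : R[X]} {m n N : ℕ}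
    (ha : a.natDegree ≤ m) (hb : b.natDegree ≤ n) (h1 : m + (n - 1) ≤ N) (h2 : m - 1 + n ≤ N) :
    (wronskian a b).natDegree ≤ N := by
  have ha' := natDegree_derivative_le a
  have hb' := natDegree_derivative_le b
  refine (natDegree_sub_le _ _).trans (max_le ?_ ?_)
  · exact natDegree_mul_le.trans (by omega)
  · exact natDegree_mul_le.trans (by omega)

/-- The expected degree `2k - 1` drops by one because the Wronskian of the two leading terms `c Xᵏ`,
`d Xᵏ` vanishes. -/
theorem natDegree_wronskian_le {R : Type*} [CommRing R] {a b : R[X]} {k : ℕ}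
    (ha : a.natDegree ≤ k) (hb : b.natDegree ≤ k) :
    (wronskian a b).natDegree ≤ 2 * k - 2 := by
  -- Small `k` is separate because truncated subtraction makes the degree count below fail at `k =
  -- 1`.
  rcases Nat.lt_or_ge k 2 with hk | hk
  · obtain ⟨a₁, a₀, rfl⟩ := exists_eq_X_add_C_of_natDegree_le_one (ha.trans (by omega : k ≤ 1))
    obtain ⟨b₁, b₀, rfl⟩ := exists_eq_X_add_C_of_natDegree_le_one (hb.trans (by omega : k ≤ 1))
    have : wronskian (C a₁ * X + C a₀) (C b₁ * X + C b₀) = C (a₀ * b₁ - a₁ * b₀) := by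
      simp [wronskian]; ring
    rw [this, natDegree_C]
    omega
  have split : ∀ p : R[X], p.natDegree ≤ k →
      ∃ (c : R) (q : R[X]), q.natDegree ≤ k - 1 ∧ p = C c * X ^ k + q := fun p hp =>
    ⟨p.coeff k, p.erase k, by
      refine natDegree_le_iff_coeff_eq_zero.2 fun N hN => ?_
      rw [coeff_erase]
      split_ifs with h
      · rfl
      · exact coeff_eq_zero_of_natDegree_lt (by omega), by
      rw [C_mul_X_pow_eq_monomial, monomial_add_erase]⟩
  obtain ⟨c, q, hq, rfl⟩ := split a ha
  obtain ⟨d, r, hr, rfl⟩ := split b hb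
  have hX : ∀ e : R, (C e * X ^ k).natDegree ≤ k := fun e => natDegree_C_mul_X_pow_le _ _
  have h0 : wronskian (C c * X ^ k) (C d * X ^ k) = 0 := by
    simp [wronskian]; ring
  rw [wronskian_add_left, wronskian_add_right, wronskian_add_right, h0, zero_add]
  refine natDegree_add_le_of_degree_le ?_ (natDegree_add_le_of_degree_le ?_ ?_)
  · exact natDegree_wronskian_le_of_le (hX c) hr (by omega) (by omega)
  · exact natDegree_wronskian_le_of_le hq (hX d) (by omega) (by omega)
  · exact natDegree_wronskian_le_of_le hq hr (by omega) (by omega)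

theorem wronskian_map {R S : Type*} [CommRing R] [CommRing S] (φ : R →+* S) (a b : R[X]) :
    (wronskian a b).map φ = wronskian (a.map φ) (b.map φ) := by
  simp [wronskian, derivative_map]

/-- In a polynomial family of polynomials of degree at most `d`, being separable of degree exactly
`d` is a generic property. -/
theorem finite_not_separable (F : ℂ[X][X]) {d : ℕ} (hd : 0 < d) (hF : F.natDegree ≤ d) {t₀ : ℂ}
    (h1 : (F.map (evalRingHom t₀)).natDegree = d) (h2 : (F.map (evalRingHom t₀)).Separable) :
    {t : ℂ | ¬ ((F.map (evalRingHom t)).natDegree = d ∧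
      (F.map (evalRingHom t)).Separable)}.Finite := by
  -- The formal degrees `d` and `d - 1` are fixed, so the resultant commutes with specialization of
  -- `t`. Nonvanishing of `r` at `t` then gives both exact degree and separability.
  set r : ℂ[X] := F.coeff d * resultant F (derivative F) d (d - 1) with hr
  have hres : ∀ t, r.eval t = (F.map (evalRingHom t)).coeff d *
      resultant (F.map (evalRingHom t)) (derivative (F.map (evalRingHom t))) d (d - 1) := by
    intro t
    rw [derivative_map, resultant_map_map, coeff_map, hr, eval_mul, coe_evalRingHom]
  have hr0 : r ≠ 0 := by
    intro h
    have := hres t₀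
    rw [h, eval_zero] at this
    rcases mul_eq_zero.1 this.symm with h | h
    · rw [← h1, coeff_natDegree, leadingCoeff_eq_zero] at h
      rw [h, natDegree_zero] at h1
      omega
    · have hres := resultant_ne_zero _ _ h2
      rw [natDegree_derivative, h1] at hres
      exact hres h
  refine r.roots.toFinset.finite_toSet.subset fun t ht => ?_
  simp only [mem_coe, Multiset.mem_toFinset, mem_roots hr0, IsRoot.def]
  by_contra hne
  rw [hres] at hne
  obtain ⟨h3, h4⟩ := mul_ne_zero_iff.1 hne
  have hle : (F.map (evalRingHom t)).natDegree ≤ d := natDegree_map_le.trans hF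
  have hle' := natDegree_derivative_le (F.map (evalRingHom t))
  obtain ⟨p, q, -, -, hpq⟩ := exists_mul_add_mul_eq_C_resultant (m := d) (n := d - 1)
    (F.map (evalRingHom t)) (derivative (F.map (evalRingHom t))) hle (by omega) (by omega)
  refine ht ⟨le_antisymm hle (le_natDegree_of_ne_zero h3), ?_⟩
  set s := resultant (F.map (evalRingHom t)) (derivative (F.map (evalRingHom t))) d (d - 1)
  refine ⟨C s⁻¹ * p, C s⁻¹ * q, ?_⟩
  calc _ = C s⁻¹ * (F.map (evalRingHom t) * p + derivative (F.map (evalRingHom t)) * q) := by ring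
    _ = 1 := by rw [hpq, ← C_mul, inv_mul_cancel₀ h4, C_1]

/-- There are polynomials of degree at most `k` whose Wronskian is separable of degree
`2k - 2`. -/
theorem exists_separable_wronskian {k : ℕ} (hk : 3 ≤ k) :
    ∃ P Q : ℂ[X], P.natDegree ≤ k ∧ Q.natDegree ≤ k ∧ (wronskian P Q).natDegree = 2 * k - 2 ∧
      (wronskian P Q).Separable := by
  obtain ⟨l, rfl⟩ := Nat.exists_eq_add_of_le' (show 2 ≤ k by omega)
  have hl : (l : ℂ) ≠ 0 := by
    have : l ≠ 0 := by omega
    exact_mod_cast this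
  have hl2 : (l : ℂ) + 2 ≠ 0 := by exact_mod_cast (show l + 2 ≠ 0 by omega)
  -- The value that cancels the `X^(l+1)` term of the Wronskian, leaving a binomial. It needs `l ≠
  -- 0`, that is `k ≥ 3`.
  set β : ℂ := (l + 2) / l with hβ
  have hβ0 : β ≠ 0 := div_ne_zero hl2 hl
  have hW : wronskian (X ^ (l + 2) + X : ℂ[X]) (1 + C β * X ^ (l + 1)) =
      C (-β) * (X ^ (2 * (l + 2) - 2) - C (-β⁻¹)) := by
    have e : C β * (l : ℂ[X]) = l + 2 := by
      rw [← C_eq_natCast, ← C_mul, hβ, div_mul_cancel₀ _ hl, C_add, C_eq_natCast, C_ofNat]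
    have e2 : C β * C β⁻¹ = (1 : ℂ[X]) := by rw [← C_mul, mul_inv_cancel₀ hβ0, C_1]
    rw [show 2 * (l + 2) - 2 = l + 1 + (l + 1) by omega]
    simp only [wronskian, derivative_add, derivative_X_pow, derivative_X, derivative_one,
      derivative_mul, derivative_C, zero_mul, zero_add, C_neg, Nat.add_sub_cancel,
      map_natCast, show l + 2 - 1 = l + 1 by omega]
    push_cast
    linear_combination (X ^ (l + 1)) * e + e2
  have hsep : (X ^ (2 * (l + 2) - 2) - C (-β⁻¹) : ℂ[X]).Separable := by
    refine separable_X_pow_sub_C _ ?_ (by simpa using hβ0)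
    exact_mod_cast (show 2 * (l + 2) - 2 ≠ 0 by omega)
  refine ⟨X ^ (l + 2) + X, 1 + C β * X ^ (l + 1), ?_, ?_, ?_, ?_⟩
  · refine natDegree_add_le_of_degree_le (natDegree_X_pow_le _) (natDegree_X_le.trans (by omega))
  · refine natDegree_add_le_of_degree_le (natDegree_one.le.trans (by omega))
      ((natDegree_C_mul_X_pow_le _ _).trans (by omega))
  · rw [hW, natDegree_C_mul (neg_ne_zero.2 hβ0), natDegree_X_pow_sub_C]
  · rw [hW]
    exact hsep.unit_mul (isUnit_C.2 (IsUnit.mk0 _ (neg_ne_zero.2 hβ0)))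

/-- Every pair of polynomials of degree at most `k` has a perturbation whose Wronskian is separable
of degree `2k - 2`. -/
theorem exists_perturbation {k : ℕ} (hk : 3 ≤ k) {P Q : ℂ[X]} (hP : P.natDegree ≤ k)
    (hQ : Q.natDegree ≤ k) : ∃ P₀ Q₀ : ℂ[X], P₀.natDegree ≤ k ∧ Q₀.natDegree ≤ k ∧
      ∀ δ : ℝ, 0 < δ → ∃ ε : ℝ, 0 < ε ∧ ε < δ ∧
        (wronskian (P + C (ε : ℂ) * P₀) (Q + C (ε : ℂ) * Q₀)).natDegree = 2 * k - 2 ∧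
        (wronskian (P + C (ε : ℂ) * P₀) (Q + C (ε : ℂ) * Q₀)).Separable := by
  obtain ⟨P₀, Q₀, hP₀, hQ₀, hd, hs⟩ := exists_separable_wronskian hk
  refine ⟨P₀, Q₀, hP₀, hQ₀, fun δ hδ => ?_⟩
  -- The family `P₀ + tP`, `Q₀ + tQ` is good at `t = 0`, hence at some `t > 1/δ`. Dividing by `t`
  -- gives the perturbation with `ε = 1/t`, and only multiplies the Wronskian by `t⁻²`.
  let lift : ℂ[X] → ℂ[X] → ℂ[X][X] := fun p q => q.map C + C X * p.map C
  have hlift : ∀ t p q, (lift p q).map (evalRingHom t) = q + C t * p := by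
    intro t p q
    have hc : (evalRingHom t).comp C = RingHom.id ℂ := by ext; simp
    simp [lift, Polynomial.map_map, hc]
  have hdeg : ∀ p q : ℂ[X], p.natDegree ≤ k → q.natDegree ≤ k → (lift p q).natDegree ≤ k :=
    fun p q hp hq => natDegree_add_le_of_degree_le (natDegree_map_le.trans hq)
      ((natDegree_C_mul_le _ _).trans (natDegree_map_le.trans hp))
  have hfin := finite_not_separable (wronskian (lift P P₀) (lift Q Q₀)) (d := 2 * k - 2)
    (t₀ := 0) (by omega) (natDegree_wronskian_le (hdeg _ _ hP hP₀) (hdeg _ _ hQ hQ₀))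
    (by rw [wronskian_map, hlift, hlift]; simpa using hd)
    (by rw [wronskian_map, hlift, hlift]; simpa using hs)
  have hinf : ((fun x : ℝ => (x : ℂ)) '' Set.Ioi δ⁻¹).Infinite :=
    (Set.Ioi_infinite _).image Complex.ofReal_injective.injOn
  obtain ⟨_, ⟨t, ht, rfl⟩, ht'⟩ := hinf.exists_notMem_finite hfin
  simp only [Set.mem_ofPred_eq, not_not, wronskian_map, hlift] at ht'
  have ht0 : 0 < t := (inv_pos.2 hδ).trans ht
  have htc : (t : ℂ) ≠ 0 := by exact_mod_cast ht0.ne'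
  have key : wronskian (P + C ((t⁻¹ : ℝ) : ℂ) * P₀) (Q + C ((t⁻¹ : ℝ) : ℂ) * Q₀) =
      C ((t : ℂ)⁻¹ ^ 2) * wronskian (P₀ + C (t : ℂ) * P) (Q₀ + C (t : ℂ) * Q) := by
    have e : C (t : ℂ)⁻¹ * C (t : ℂ) = 1 := by rw [← C_mul, inv_mul_cancel₀ htc, C_1]
    have h : ∀ p q : ℂ[X], p + C ((t⁻¹ : ℝ) : ℂ) * q = C (t : ℂ)⁻¹ * (q + C (t : ℂ) * p) := by
      intro p q
      push_cast
      linear_combination -p * e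
    rw [h, h]
    simp only [wronskian, derivative_C_mul, C_pow]
    ring
  have hu : (t : ℂ)⁻¹ ^ 2 ≠ 0 := pow_ne_zero _ (inv_ne_zero htc)
  refine ⟨t⁻¹, inv_pos.2 ht0, (inv_lt_comm₀ ht0 hδ).2 ht, ?_, ?_⟩
  · rw [key, natDegree_C_mul hu, ht'.1]
  · rw [key]
    exact ht'.2.unit_mul (isUnit_C.2 (IsUnit.mk0 _ hu))

/-! ### Growth bounds and stability under perturbation -/

theorem norm_eval_le {p : ℂ[X]} {k : ℕ} (hp : p.natDegree ≤ k) : ∃ A : ℝ, 0 ≤ A ∧ ∀ z : ℂ,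
    ‖p.eval z‖ ≤ A * √(1 + ‖z‖ ^ 2) ^ k := by
  refine ⟨∑ i ∈ range (k + 1), ‖p.coeff i‖, by positivity, fun z => ?_⟩
  have hz1 : 1 ≤ √(1 + ‖z‖ ^ 2) := Real.one_le_sqrt.2 (by nlinarith [norm_nonneg z])
  have hz : ‖z‖ ≤ √(1 + ‖z‖ ^ 2) := Real.le_sqrt_of_sq_le (by linarith)
  rw [eval_eq_sum_range' (Nat.lt_succ_of_le hp), sum_mul]
  refine (norm_sum_le _ _).trans (sum_le_sum fun i hi => ?_)
  rw [norm_mul, norm_pow]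
  gcongr
  calc ‖z‖ ^ i ≤ √(1 + ‖z‖ ^ 2) ^ i := by gcongr
    _ ≤ _ := pow_le_pow_right₀ hz1 (by simp at hi; omega)

theorem sqrt_one_add_pow_sq (z : ℂ) (k : ℕ) :
    (√(1 + ‖z‖ ^ 2) ^ k) ^ 2 = (1 + ‖z‖ ^ 2) ^ k := by
  rw [← pow_mul, mul_comm k, pow_mul, Real.sq_sqrt (by positivity)]

theorem sq_norm_eval_le {p : ℂ[X]} {k : ℕ} (hp : p.natDegree ≤ k) : ∃ A : ℝ, 0 ≤ A ∧ ∀ z : ℂ,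
    ‖p.eval z‖ ^ 2 ≤ A * (1 + ‖z‖ ^ 2) ^ k := by
  obtain ⟨A, -, hA⟩ := norm_eval_le hp
  refine ⟨A ^ 2, by positivity, fun z => ?_⟩
  rw [← sqrt_one_add_pow_sq, ← mul_pow]
  exact pow_le_pow_left₀ (norm_nonneg _) (hA z) 2

/-- The pair of `exists_balanced_pair` can be chosen with a separable Wronskian of degree
`2k - 2`. -/
theorem exists_balanced_pair_separable : ∃ M₁ M₂ : ℝ, 0 < M₁ ∧ ∀ k : ℕ, 4 ≤ k →
    ∃ P Q : ℂ[X], P.natDegree ≤ k ∧ Q.natDegree ≤ k ∧ (wronskian P Q).natDegree = 2 * k - 2 ∧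
      (wronskian P Q).Separable ∧ ∀ z : ℂ,
      M₁ * (1 + ‖z‖ ^ 2) ^ k ≤ ‖P.eval z‖ ^ 2 + ‖Q.eval z‖ ^ 2 ∧
      ‖P.eval z‖ ^ 2 + ‖Q.eval z‖ ^ 2 ≤ M₂ * (1 + ‖z‖ ^ 2) ^ k := by
  obtain ⟨M₁, M₂, hM, h⟩ := exists_balanced_pair
  refine ⟨M₁ / 4, 2 * M₂ + M₁, by positivity, fun k hk => ?_⟩
  obtain ⟨P, Q, hP, hQ, hPQ⟩ := h k hk
  obtain ⟨P₀, Q₀, hP₀, hQ₀, hpert⟩ := exists_perturbation (by omega : 3 ≤ k) hP hQ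
  obtain ⟨A, hA0, hA⟩ := sq_norm_eval_le hP₀
  obtain ⟨B, hB0, hB⟩ := sq_norm_eval_le hQ₀
  -- `A` and `B` may depend on `k`, but `ε` is chosen after them, so the final constants do not.
  obtain ⟨ε, hε0, hε, hd, hs⟩ := hpert (min 1 (M₁ / (4 * (A + B + 1)))) (by positivity)
  have hε1 : ε < 1 := hε.trans_le (min_le_left _ _)
  have hε2 : ε * (4 * (A + B + 1)) < M₁ :=
    (lt_div_iff₀ (by positivity)).1 (hε.trans_le (min_le_right _ _))
  have hdeg : ∀ p q : ℂ[X], p.natDegree ≤ k → q.natDegree ≤ k →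
      (p + C (ε : ℂ) * q).natDegree ≤ k := fun p q hp hq =>
    natDegree_add_le_of_degree_le hp ((natDegree_C_mul_le _ _).trans hq)
  refine ⟨_, _, hdeg _ _ hP hP₀, hdeg _ _ hQ hQ₀, hd, hs, fun z => ?_⟩
  obtain ⟨hlow, hup⟩ := hPQ z
  have hD : 0 < (1 + ‖z‖ ^ 2) ^ k := by positivity
  set D := (1 + ‖z‖ ^ 2) ^ k
  have pert : ∀ a b : ℂ, ‖a‖ ^ 2 / 2 - ε * ‖b‖ ^ 2 ≤ ‖a + ε * b‖ ^ 2 ∧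
      ‖a + ε * b‖ ^ 2 ≤ 2 * ‖a‖ ^ 2 + 2 * ε * ‖b‖ ^ 2 := by
    intro a b
    have h1 := norm_add_le a (ε * b)
    have h2 := norm_sub_norm_le a (-(ε * b))
    rw [sub_neg_eq_add, norm_neg] at h2
    have he : ‖(ε : ℂ) * b‖ = ε * ‖b‖ := by
      rw [norm_mul, Complex.norm_real, Real.norm_of_nonneg hε0.le]
    rw [he] at h1 h2
    set c := ‖a + ε * b‖
    have hc : 0 ≤ c := norm_nonneg _
    have hb := norm_nonneg b
    have ha := norm_nonneg a
    have hsq : (ε * ‖b‖) ^ 2 ≤ ε * ‖b‖ ^ 2 := by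
      rw [mul_pow]
      gcongr
      nlinarith
    constructor
    · nlinarith [sq_nonneg (c - ε * ‖b‖), pow_le_pow_left₀ ha (show ‖a‖ ≤ c + ε * ‖b‖ by linarith) 2]
    · nlinarith [sq_nonneg (‖a‖ - ε * ‖b‖), pow_le_pow_left₀ hc h1 2]
  simp only [eval_add, eval_mul, eval_C]
  have p1 := pert (P.eval z) (P₀.eval z)
  have p2 := pert (Q.eval z) (Q₀.eval z)
  have h3 : ε * (‖P₀.eval z‖ ^ 2 + ‖Q₀.eval z‖ ^ 2) ≤ M₁ / 4 * D := by
    calc ε * (‖P₀.eval z‖ ^ 2 + ‖Q₀.eval z‖ ^ 2) ≤ ε * (A * D + B * D) := by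
          gcongr
          · exact hA z
          · exact hB z
      _ = (ε * (A + B)) * D := by ring
      _ ≤ M₁ / 4 * D := by gcongr; nlinarith
  have hMD : 0 < M₁ * D := by positivity
  constructor
  · linarith [p1.1, p2.1]
  · linarith [p1.2, p2.2]

/-! ### The Laplacian of `log(|P|² + |Q|²)` -/

theorem laplacian_eq_fderiv_fderiv {f : ℂ → ℝ} (hf : ContDiff ℝ 2 f) (z : ℂ) :
    Laplacian.laplacian f z = fderiv ℝ (fun x => fderiv ℝ f x 1) z 1 +
      fderiv ℝ (fun x => fderiv ℝ f x Complex.I) z Complex.I := by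
  have hd : DifferentiableAt ℝ (fderiv ℝ f) z :=
    ((hf.fderiv_right (m := 1) (by norm_num)).differentiable (by norm_num)) z
  have h : ∀ e : ℂ, fderiv ℝ (fun x => fderiv ℝ f x e) z e = fderiv ℝ (fderiv ℝ f) z e e := by
    intro e
    rw [fderiv_clm_apply hd (differentiableAt_const e)]
    simp
  rw [laplacian_eq_iteratedFDeriv_complexPlane, h, h]
  simp [iteratedFDeriv_two_apply]

theorem laplacian_eq_of_hasLineDerivAt {f g₁ g₂ : ℂ → ℝ} {a b : ℝ} {z : ℂ} (hf : ContDiff ℝ 2 f)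
    (h₁ : ∀ x, HasLineDerivAt ℝ f (g₁ x) x 1) (h₂ : ∀ x, HasLineDerivAt ℝ f (g₂ x) x Complex.I)
    (ha : HasLineDerivAt ℝ g₁ a z 1) (hb : HasLineDerivAt ℝ g₂ b z Complex.I) :
    Laplacian.laplacian f z = a + b := by
  have hd : Differentiable ℝ f := hf.differentiable (by norm_num)
  have hg : ∀ e, Differentiable ℝ fun x => fderiv ℝ f x e := fun e =>
    ((hf.fderiv_right (m := 1) (by norm_num)).clm_apply contDiff_const).differentiable (by norm_num)
  have e₁ : (fun x => fderiv ℝ f x 1) = g₁ := by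
    ext x; rw [← (hd x).lineDeriv_eq_fderiv, (h₁ x).lineDeriv]
  have e₂ : (fun x => fderiv ℝ f x Complex.I) = g₂ := by
    ext x; rw [← (hd x).lineDeriv_eq_fderiv, (h₂ x).lineDeriv]
  have hg₁ := hg 1 z
  have hg₂ := hg Complex.I z
  rw [e₁] at hg₁
  rw [e₂] at hg₂
  rw [laplacian_eq_fderiv_fderiv hf, e₁, e₂, ← hg₁.lineDeriv_eq_fderiv,
    ← hg₂.lineDeriv_eq_fderiv, ha.lineDeriv, hb.lineDeriv]

/-- The function `|P|² + |Q|²`. -/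
noncomputable def sumSq (P Q : ℂ[X]) (z : ℂ) : ℝ := ‖P.eval z‖ ^ 2 + ‖Q.eval z‖ ^ 2

theorem contDiff_eval (P : ℂ[X]) {n : WithTop ℕ∞} : ContDiff ℝ n fun z : ℂ => P.eval z := by
  simpa [Polynomial.aeval_def] using (P.contDiff_aeval (𝕜 := ℂ) n).restrict_scalars ℝ

theorem contDiff_log_sumSq {P Q : ℂ[X]} (h : ∀ z, 0 < sumSq P Q z) {n : WithTop ℕ∞} :
    ContDiff ℝ n fun z => Real.log (sumSq P Q z) :=
  (((contDiff_eval P).norm_sq ℝ).add ((contDiff_eval Q).norm_sq ℝ)).log fun z => (h z).ne'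

theorem hasDerivAt_eval_line (P : ℂ[X]) (x e : ℂ) :
    HasDerivAt (fun t : ℝ => P.eval (x + t • e)) ((derivative P).eval x * e) 0 := by
  have h1 : HasDerivAt (fun t : ℝ => x + t • e) e 0 := by
    simpa using ((hasDerivAt_id (0 : ℝ)).smul_const e).const_add x
  have h2 : HasDerivAt (fun w => P.eval w) ((derivative P).eval (x + (0 : ℝ) • e))
      (x + (0 : ℝ) • e) := P.hasDerivAt _
  have h3 := h2.comp (0 : ℝ) h1
  exact h3.congr_deriv (by simp)

/-- Half of the derivative of `|P|² + |Q|²` in the direction `e`. -/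
noncomputable def halfLineDeriv (P Q : ℂ[X]) (e x : ℂ) : ℝ :=
  inner ℝ (P.eval x) ((derivative P).eval x * e) + inner ℝ (Q.eval x) ((derivative Q).eval x * e)

theorem hasLineDerivAt_sumSq (P Q : ℂ[X]) (x e : ℂ) :
    HasLineDerivAt ℝ (sumSq P Q) (2 * halfLineDeriv P Q e x) x e := by
  have h := (hasDerivAt_eval_line P x e).norm_sq.add (hasDerivAt_eval_line Q x e).norm_sq
  exact HasDerivAt.congr_deriv h (by simp [halfLineDeriv]; ring)

theorem hasLineDerivAt_log_sumSq {P Q : ℂ[X]} (h : ∀ z, 0 < sumSq P Q z) (x e : ℂ) :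
    HasLineDerivAt ℝ (fun z => Real.log (sumSq P Q z)) (2 * halfLineDeriv P Q e x / sumSq P Q x)
      x e := by
  have := HasDerivAt.log (hasLineDerivAt_sumSq P Q x e) (by simpa using (h x).ne')
  exact HasDerivAt.congr_deriv this (by simp)

theorem hasLineDerivAt_halfLineDeriv (P Q : ℂ[X]) (x e : ℂ) :
    HasLineDerivAt ℝ (halfLineDeriv P Q e)
      (‖(derivative P).eval x * e‖ ^ 2 + ‖(derivative Q).eval x * e‖ ^ 2 +
        inner ℝ (P.eval x) ((derivative (derivative P)).eval x * e ^ 2) +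
        inner ℝ (Q.eval x) ((derivative (derivative Q)).eval x * e ^ 2)) x e := by
  have h : ∀ P : ℂ[X], HasDerivAt (fun t : ℝ => inner ℝ (P.eval (x + t • e))
      ((derivative P).eval (x + t • e) * e)) (‖(derivative P).eval x * e‖ ^ 2 +
        inner ℝ (P.eval x) ((derivative (derivative P)).eval x * e ^ 2)) 0 := by
    intro P
    have := (hasDerivAt_eval_line P x e).inner ℝ
      ((hasDerivAt_eval_line (derivative P) x e).mul_const e)
    refine this.congr_deriv ?_
    rw [← real_inner_self_eq_norm_sq, zero_smul, add_zero, mul_assoc, ← sq, add_comm]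
  exact HasDerivAt.congr_deriv ((h P).add (h Q)) (by ring)

/-- The terms with `P''` and `Q''` cancel between the directions `1` and `I`, since `1² + I² = 0`.
What remains is Lagrange's identity `(|P|² + |Q|²)(|P'|² + |Q'|²) - |P̄P' + Q̄Q'|² = |PQ' - P'Q|²`.
-/
theorem laplacian_log_sumSq {P Q : ℂ[X]} (h : ∀ z, 0 < sumSq P Q z) (z : ℂ) :
    Laplacian.laplacian (fun z => Real.log (sumSq P Q z)) z / 4 =
      ‖(wronskian P Q).eval z‖ ^ 2 / sumSq P Q z ^ 2 := by
  have h2 : ∀ e, HasLineDerivAt ℝ (fun x => 2 * halfLineDeriv P Q e x / sumSq P Q x) _ z e :=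
    fun e => HasDerivAt.div ((hasLineDerivAt_halfLineDeriv P Q z e).const_mul 2)
      (hasLineDerivAt_sumSq P Q z e) (by simpa using (h z).ne')
  rw [laplacian_eq_of_hasLineDerivAt (contDiff_log_sumSq h) (fun x => hasLineDerivAt_log_sumSq h x _)
    (fun x => hasLineDerivAt_log_sumSq h x _) (h2 1) (h2 Complex.I)]
  have hz := (h z).ne'
  simp only [zero_smul, add_zero]
  rw [← add_div, div_div, div_eq_div_iff (by positivity) (by positivity)]
  simp only [wronskian, eval_sub, eval_mul, halfLineDeriv, Complex.inner, Complex.sq_norm,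
    Complex.normSq_apply, Complex.mul_re, Complex.mul_im, Complex.sub_re, Complex.sub_im,
    Complex.conj_re, Complex.conj_im, Complex.I_re, Complex.I_im, Complex.one_re, Complex.one_im,
    Complex.I_sq, one_pow, Complex.neg_re, Complex.neg_im]
  simp only [sumSq, Complex.sq_norm, Complex.normSq_apply]
  ring

/-! ### Integrals of Laplacians over the plane -/

theorem integral_mul_fderiv_fderiv {f χ : ℂ → ℝ} (hf : ContDiff ℝ 2 f) (hχ : ContDiff ℝ 1 χ)
    (hc : HasCompactSupport χ) (e : ℂ) :
    ∫ z, χ z * fderiv ℝ (fun x => fderiv ℝ f x e) z e = - ∫ z, fderiv ℝ χ z e * fderiv ℝ f z e := by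
  have hg : ContDiff ℝ 1 fun x => fderiv ℝ f x e :=
    (hf.fderiv_right (m := 1) (by norm_num)).clm_apply contDiff_const
  have hχ' : Continuous fun x => fderiv ℝ χ x e :=
    (hχ.continuous_fderiv (by norm_num)).clm_apply continuous_const
  have hg' : Continuous fun x => fderiv ℝ (fun x => fderiv ℝ f x e) x e :=
    (hg.continuous_fderiv (by norm_num)).clm_apply continuous_const
  refine integral_mul_fderiv_eq_neg_fderiv_mul_of_integrable ?_ ?_ ?_
    (fun x _ => hχ.differentiable (by norm_num) x) (fun x _ => hg.differentiable (by norm_num) x)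
  · exact (hχ'.mul hg.continuous).integrable_of_hasCompactSupport (hc.fderiv_apply ℝ e).mul_right
  · exact (hχ.continuous.mul hg').integrable_of_hasCompactSupport hc.mul_right
  · exact (hχ.continuous.mul hg.continuous).integrable_of_hasCompactSupport hc.mul_right

/-- There are cutoff functions exhausting the plane with uniformly decaying derivatives. -/
theorem exists_cutoff : ∃ (χ : ℕ → ℂ → ℝ) (K : ℝ), 0 ≤ K ∧ ∀ n, ContDiff ℝ 1 (χ n) ∧
    HasCompactSupport (χ n) ∧ (∀ z, ‖χ n z‖ ≤ 1) ∧
    (∀ z, Tendsto (fun n => χ n z) atTop (𝓝 1)) ∧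
    ∀ z, ‖fderiv ℝ (χ n) z‖ ≤ K / (n + 1 + ‖z‖) := by
  let b : ContDiffBump (0 : ℂ) := ⟨1, 2, one_pos, by norm_num⟩
  have hb : ContDiff ℝ 1 (b : ℂ → ℝ) := b.contDiff
  obtain ⟨K, hK⟩ : ∃ K, ∀ w, ‖(1 + ‖w‖) * ‖fderiv ℝ b w‖‖ ≤ K := by
    refine Continuous.bounded_above_of_compact_support
      (.mul (by fun_prop) (hb.continuous_fderiv (by norm_num)).norm) ?_
    exact (b.hasCompactSupport.fderiv ℝ).norm.mul_left
  have hK0 : 0 ≤ K := (norm_nonneg _).trans (hK 0)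
  -- Rescaling turns the bound `(1 + |w|) |Db(w)| ≤ K` into `K / (n + 1 + |z|)`.
  refine ⟨fun n z => b (((n : ℝ) + 1)⁻¹ • z), K, hK0, fun n => ?_⟩
  have hn : (0 : ℝ) < n + 1 := by positivity
  have hn' : ((n : ℝ) + 1)⁻¹ ≠ 0 := by positivity
  refine ⟨hb.comp (contDiff_const_smul _), b.hasCompactSupport.comp_smul hn', fun z => ?_,
    fun z => ?_, fun z => ?_⟩
  · rw [Real.norm_of_nonneg b.nonneg]; exact b.le_one
  · have h1 : Tendsto (fun n : ℕ => ((n : ℝ) + 1)⁻¹ • z) atTop (𝓝 0) := by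
      have := (tendsto_inv_atTop_zero.comp (tendsto_atTop_add_const_right atTop (1 : ℝ)
        tendsto_natCast_atTop_atTop)).smul_const z
      simpa using this
    have h2 := (hb.continuous.tendsto 0).comp h1
    rwa [b.one_of_mem_closedBall (by simp [b])] at h2
  · have h := hK (((n : ℝ) + 1)⁻¹ • z)
    rw [fderiv_comp_smul, norm_smul, le_div_iff₀ (by positivity), Real.norm_of_nonneg (by positivity)]
    rw [Real.norm_of_nonneg (by positivity), norm_smul, Real.norm_of_nonneg (by positivity)] at h
    refine le_trans (le_of_eq ?_) h
    field_simp

/-- Integration by parts against the cutoffs leaves `∇χₙ · ∇f`. This tends to zero pointwise and is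
dominated by a multiple of `(1 + |z|)⁻³`, which is integrable in the plane. -/
theorem integral_laplacian_eq_zero {f : ℂ → ℝ} {C : ℝ} (hf : ContDiff ℝ 2 f)
    (hC : ∀ z, ‖fderiv ℝ f z‖ ≤ C / (1 + ‖z‖ ^ 2))
    (hint : Integrable (Laplacian.laplacian f)) : ∫ z, Laplacian.laplacian f z = 0 := by
  obtain ⟨χ, K, hK0, hχ⟩ := exists_cutoff
  have hC0 : 0 ≤ C := by simpa using (norm_nonneg _).trans (hC 0)
  have hparts : ∀ n, ∫ z, χ n z * Laplacian.laplacian f z =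
      - ∫ z, (fderiv ℝ (χ n) z 1 * fderiv ℝ f z 1 +
        fderiv ℝ (χ n) z Complex.I * fderiv ℝ f z Complex.I) := by
    intro n
    obtain ⟨h1, h2, -, -⟩ := hχ n
    have hg : ∀ e, ContDiff ℝ 1 fun x => fderiv ℝ f x e := fun e =>
      (hf.fderiv_right (m := 1) (by norm_num)).clm_apply contDiff_const
    have i1 : ∀ e, Integrable fun z => χ n z * fderiv ℝ (fun x => fderiv ℝ f x e) z e := fun e =>
      (h1.continuous.mul (((hg e).continuous_fderiv (by norm_num)).clm_apply
        continuous_const)).integrable_of_hasCompactSupport h2.mul_right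
    have i2 : ∀ e, Integrable fun z => fderiv ℝ (χ n) z e * fderiv ℝ f z e := fun e =>
      (((h1.continuous_fderiv (by norm_num)).clm_apply continuous_const).mul
        (hg e).continuous).integrable_of_hasCompactSupport (h2.fderiv_apply ℝ e).mul_right
    simp_rw [laplacian_eq_fderiv_fderiv hf, mul_add]
    rw [integral_add (i1 _) (i1 _), integral_add (i2 _) (i2 _),
      integral_mul_fderiv_fderiv hf h1 h2, integral_mul_fderiv_fderiv hf h1 h2]
    ring
  have lim1 : Tendsto (fun n => ∫ z, χ n z * Laplacian.laplacian f z) atTop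
      (𝓝 (∫ z, Laplacian.laplacian f z)) := by
    refine tendsto_integral_of_dominated_convergence (fun z => ‖Laplacian.laplacian f z‖)
      (fun n => ((hχ n).1.continuous.aestronglyMeasurable.mul hint.1)) hint.norm
      (fun n => .of_forall fun z => ?_) (.of_forall fun z => ?_)
    · rw [norm_mul]
      exact mul_le_of_le_one_left (norm_nonneg _) ((hχ n).2.2.1 z)
    · simpa using ((hχ 0).2.2.2.1 z).mul_const (Laplacian.laplacian f z)
  have bound : ∀ n z, ‖fderiv ℝ (χ n) z 1 * fderiv ℝ f z 1 +
        fderiv ℝ (χ n) z Complex.I * fderiv ℝ f z Complex.I‖ ≤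
      2 * (K / (n + 1 + ‖z‖) * (C / (1 + ‖z‖ ^ 2))) := by
    intro n z
    have h : ∀ e : ℂ, ‖e‖ = 1 → ‖fderiv ℝ (χ n) z e * fderiv ℝ f z e‖ ≤
        K / (n + 1 + ‖z‖) * (C / (1 + ‖z‖ ^ 2)) := by
      intro e he
      rw [norm_mul]
      gcongr
      · exact (ContinuousLinearMap.le_opNorm _ _).trans (by rw [he, mul_one]; exact (hχ n).2.2.2.2 z)
      · exact (ContinuousLinearMap.le_opNorm _ _).trans (by rw [he, mul_one]; exact hC z)
    linarith [norm_add_le (fderiv ℝ (χ n) z 1 * fderiv ℝ f z 1)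
      (fderiv ℝ (χ n) z Complex.I * fderiv ℝ f z Complex.I), h 1 (by simp), h Complex.I (by simp)]
  have lim2 : Tendsto (fun n => ∫ z, (fderiv ℝ (χ n) z 1 * fderiv ℝ f z 1 +
        fderiv ℝ (χ n) z Complex.I * fderiv ℝ f z Complex.I)) atTop (𝓝 (∫ z : ℂ, (0 : ℝ))) := by
    refine tendsto_integral_of_dominated_convergence
      (fun z => (4 * K * C) * (1 + ‖z‖) ^ (-3 : ℝ)) (fun n => ?_) ?_ (fun n => .of_forall fun z => ?_)
      (.of_forall fun z => ?_)
    · have h1 := (hχ n).1.continuous_fderiv (by norm_num)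
      have h2 := hf.continuous_fderiv (by norm_num)
      exact Continuous.aestronglyMeasurable (by fun_prop)
    · refine (integrable_one_add_norm ?_).const_mul _
      rw [Complex.finrank_real_complex]; norm_num
    · refine (bound n z).trans ?_
      have hz := norm_nonneg z
      rw [Real.rpow_neg (by positivity), show (3 : ℝ) = (3 : ℕ) by norm_num, Real.rpow_natCast]
      rw [div_mul_div_comm, ← mul_div_assoc, ← div_eq_mul_inv, div_le_div_iff₀ (by positivity)
        (by positivity)]
      have h3 : (1 + ‖z‖) ^ 3 ≤ 2 * (((n : ℝ) + 1 + ‖z‖) * (1 + ‖z‖ ^ 2)) := by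
        have : (1 + ‖z‖) ^ 2 ≤ 2 * (1 + ‖z‖ ^ 2) := by nlinarith [sq_nonneg (1 - ‖z‖)]
        calc (1 + ‖z‖) ^ 3 = (1 + ‖z‖) * (1 + ‖z‖) ^ 2 := by ring
          _ ≤ ((n : ℝ) + 1 + ‖z‖) * (2 * (1 + ‖z‖ ^ 2)) := by
            gcongr
            linarith [(Nat.cast_nonneg n : (0 : ℝ) ≤ n)]
          _ = _ := by ring
      calc 2 * (K * C) * (1 + ‖z‖) ^ 3 ≤
          2 * (K * C) * (2 * (((n : ℝ) + 1 + ‖z‖) * (1 + ‖z‖ ^ 2))) := by gcongr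
        _ = _ := by ring
    · refine squeeze_zero_norm (fun n => bound n z) ?_
      have h1 : Tendsto (fun n : ℕ => (n : ℝ) + 1 + ‖z‖) atTop atTop :=
        tendsto_atTop_add_const_right _ _ (tendsto_atTop_add_const_right _ _
          tendsto_natCast_atTop_atTop)
      have h2 := ((h1.const_div_atTop K).mul_const (C / (1 + ‖z‖ ^ 2))).const_mul 2
      simpa using h2
  simp_rw [hparts] at lim1
  simpa using tendsto_nhds_unique lim1 lim2.neg

/-! ### Gradient decay and total curvature -/

theorem sumSq_one_X (z : ℂ) : sumSq 1 X z = 1 + ‖z‖ ^ 2 := by simp [sumSq]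

theorem sumSq_one_X_pos (z : ℂ) : 0 < sumSq 1 X z := by rw [sumSq_one_X]; positivity

/-- The logarithm of `(|P|² + |Q|²) / (1 + |z|²)ᵏ`. -/
noncomputable def logRatio (k : ℕ) (P Q : ℂ[X]) (z : ℂ) : ℝ :=
  Real.log (sumSq P Q z) - k * Real.log (sumSq 1 X z)

theorem contDiff_logRatio {k : ℕ} {P Q : ℂ[X]} (h : ∀ z, 0 < sumSq P Q z) {n : WithTop ℕ∞} :
    ContDiff ℝ n (logRatio k P Q) :=
  (contDiff_log_sumSq h).sub (contDiff_const.mul (contDiff_log_sumSq sumSq_one_X_pos))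

theorem laplacian_logRatio {k : ℕ} {P Q : ℂ[X]} (h : ∀ z, 0 < sumSq P Q z) (z : ℂ) :
    Laplacian.laplacian (logRatio k P Q) z / 4 =
      ‖(wronskian P Q).eval z‖ ^ 2 / sumSq P Q z ^ 2 - k * (1 / (1 + ‖z‖ ^ 2) ^ 2) := by
  have e : logRatio k P Q = (fun z => Real.log (sumSq P Q z)) -
      (k : ℝ) • (fun z => Real.log (sumSq 1 X z)) := rfl
  have c1 := (contDiff_log_sumSq h (n := 2)).contDiffAt (x := z)
  have c2 := (contDiff_log_sumSq sumSq_one_X_pos (n := 2)).contDiffAt (x := z)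
  have l1 := laplacian_log_sumSq h z
  have l2 := laplacian_log_sumSq sumSq_one_X_pos z
  have c3 : ContDiffAt ℝ 2 ((k : ℝ) • fun z => Real.log (sumSq 1 X z)) z := c2.const_smul (k : ℝ)
  rw [e, c1.laplacian_sub c3, laplacian_smul _ c2, sub_div, l1, smul_eq_mul, mul_div_assoc, l2,
    sumSq_one_X]
  simp [wronskian]

theorem natDegree_X_mul_derivative_sub_le {P : ℂ[X]} {k : ℕ} (hP : P.natDegree ≤ k) :
    (X * derivative P - C (k : ℂ) * P).natDegree ≤ k - 1 := by
  refine natDegree_le_iff_coeff_eq_zero.2 fun N hN => ?_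
  rcases N with _ | N
  · omega
  rw [coeff_sub, coeff_X_mul, coeff_derivative, coeff_C_mul]
  rcases Nat.lt_or_ge k (N + 1) with h | h
  · simp [coeff_eq_zero_of_natDegree_lt (hP.trans_lt h)]
  · obtain rfl : k = N + 1 := by omega
    push_cast; ring

/-- With `a = P(z)` and `b = P'(z)` this rests on `(1 + |z|²)P' - k z̄ P = P' + z̄(zP' - kP)`. As
`zP' - kP` has no term in `zᵏ`, the right side grows only like `|z|ᵏ`; this cancellation yields the
decay `|z|⁻²` of the gradient. -/
theorem one_add_sq_mul_inner_sub (k : ℕ) (z e a b : ℂ) :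
    (1 + ‖z‖ ^ 2) * inner ℝ a (b * e) - k * inner ℝ z e * ‖a‖ ^ 2 =
      inner ℝ a ((b + (starRingEnd ℂ) z * (z * b - k * a)) * e) := by
  simp only [Complex.inner, Complex.sq_norm, Complex.normSq_apply, Complex.mul_re, Complex.mul_im,
    Complex.sub_re, Complex.sub_im, Complex.add_re, Complex.add_im, Complex.conj_re,
    Complex.conj_im, Complex.natCast_re, Complex.natCast_im]
  ring

theorem abs_inner_le_of_norm_le {k : ℕ} (hk : 0 < k) {s A₀ A₁ A₂ : ℝ} {a b c z e : ℂ} (hs : 1 ≤ s)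
    (hz : ‖z‖ ≤ s) (ha : ‖a‖ ≤ A₀ * s ^ k) (hb : ‖b‖ ≤ A₁ * s ^ (k - 1))
    (hc : ‖c‖ ≤ A₂ * s ^ (k - 1)) :
    |inner ℝ a ((b + (starRingEnd ℂ) z * c) * e)| ≤ A₀ * (A₁ + A₂) * (s ^ k) ^ 2 * ‖e‖ := by
  have hs0 : 0 ≤ s := zero_le_one.trans hs
  have hsk : s ^ k = s ^ (k - 1) * s := by rw [← pow_succ, Nat.sub_add_cancel hk]
  have h1 : ‖b + (starRingEnd ℂ) z * c‖ ≤ (A₁ + A₂) * s ^ k :=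
    calc ‖b + (starRingEnd ℂ) z * c‖ ≤ ‖b‖ + ‖z‖ * ‖c‖ := by
          simpa using norm_add_le b ((starRingEnd ℂ) z * c)
      _ ≤ ‖b‖ * s + s * ‖c‖ := by
          gcongr
          exact le_mul_of_one_le_right (norm_nonneg _) hs
      _ ≤ A₁ * s ^ (k - 1) * s + s * (A₂ * s ^ (k - 1)) := by gcongr
      _ = _ := by rw [hsk]; ring
  have h2 := abs_real_inner_le_norm a ((b + (starRingEnd ℂ) z * c) * e)
  rw [norm_mul] at h2
  calc _ ≤ ‖a‖ * (‖b + (starRingEnd ℂ) z * c‖ * ‖e‖) := h2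
    _ ≤ A₀ * s ^ k * ((A₁ + A₂) * s ^ k * ‖e‖) :=
        mul_le_mul ha (mul_le_mul_of_nonneg_right h1 (norm_nonneg _)) (by positivity)
          ((norm_nonneg _).trans ha)
    _ = _ := by ring

theorem norm_inner_eval_le {P : ℂ[X]} {k : ℕ} (hk : 0 < k) (hP : P.natDegree ≤ k) :
    ∃ A : ℝ, 0 ≤ A ∧ ∀ z e : ℂ,
      |(1 + ‖z‖ ^ 2) * inner ℝ (P.eval z) ((derivative P).eval z * e) -
        k * inner ℝ z e * ‖P.eval z‖ ^ 2| ≤ A * (1 + ‖z‖ ^ 2) ^ k * ‖e‖ := by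
  obtain ⟨A₀, h0, hA₀⟩ := norm_eval_le hP
  obtain ⟨A₁, h1, hA₁⟩ := norm_eval_le ((natDegree_derivative_le P).trans (Nat.sub_le_sub_right hP 1))
  obtain ⟨A₂, h2, hA₂⟩ := norm_eval_le (natDegree_X_mul_derivative_sub_le hP)
  refine ⟨A₀ * (A₁ + A₂), mul_nonneg h0 (add_nonneg h1 h2), fun z e => ?_⟩
  have h3 := hA₂ z
  rw [eval_sub, eval_mul, eval_mul, eval_X, eval_C] at h3
  rw [one_add_sq_mul_inner_sub, ← sqrt_one_add_pow_sq]
  exact abs_inner_le_of_norm_le hk (Real.one_le_sqrt.2 (le_add_of_nonneg_right (sq_nonneg _)))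
    (Real.le_sqrt_of_sq_le (le_add_of_nonneg_left zero_le_one)) (hA₀ z) (hA₁ z) h3

theorem norm_fderiv_logRatio_le {k : ℕ} {P Q : ℂ[X]} {M : ℝ} (hk : 0 < k) (hP : P.natDegree ≤ k)
    (hQ : Q.natDegree ≤ k) (hM : 0 < M) (h : ∀ z, M * (1 + ‖z‖ ^ 2) ^ k ≤ sumSq P Q z) :
    ∃ C : ℝ, ∀ z, ‖fderiv ℝ (logRatio k P Q) z‖ ≤ C / (1 + ‖z‖ ^ 2) := by
  have hpos : ∀ z, 0 < sumSq P Q z := fun z => lt_of_lt_of_le (by positivity) (h z)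
  obtain ⟨A, hA0, hA⟩ := norm_inner_eval_le hk hP
  obtain ⟨B, hB0, hB⟩ := norm_inner_eval_le hk hQ
  refine ⟨2 * (A + B) / M, fun z => ContinuousLinearMap.opNorm_le_bound _ (by positivity)
    fun e => ?_⟩
  have hd : HasLineDerivAt ℝ (logRatio k P Q) (2 * halfLineDeriv P Q e z / sumSq P Q z -
      k * (2 * halfLineDeriv 1 X e z / sumSq 1 X z)) z e :=
    HasDerivAt.sub (hasLineDerivAt_log_sumSq hpos z e)
      ((hasLineDerivAt_log_sumSq sumSq_one_X_pos z e).const_mul (k : ℝ))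
  have hdiff : DifferentiableAt ℝ (logRatio k P Q) z :=
    (contDiff_logRatio hpos (n := 1)).differentiable (by norm_num) z
  have hX : halfLineDeriv 1 X e z = inner ℝ z e := by simp [halfLineDeriv]
  rw [← hdiff.lineDeriv_eq_fderiv, hd.lineDeriv, hX, sumSq_one_X]
  set D := 1 + ‖z‖ ^ 2 with hD
  have hDpos : 0 < D := by positivity
  have hS := hpos z
  have e1 : 2 * halfLineDeriv P Q e z / sumSq P Q z - k * (2 * inner ℝ z e / D) =
      2 * ((D * inner ℝ (P.eval z) ((derivative P).eval z * e) -
        k * inner ℝ z e * ‖P.eval z‖ ^ 2) +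
        (D * inner ℝ (Q.eval z) ((derivative Q).eval z * e) -
        k * inner ℝ z e * ‖Q.eval z‖ ^ 2)) / (sumSq P Q z * D) := by
    field_simp
    simp only [halfLineDeriv, sumSq]
    ring_nf
  rw [e1, norm_div, Real.norm_of_nonneg (by positivity : 0 ≤ sumSq P Q z * D),
    div_le_iff₀ (by positivity), norm_mul, Real.norm_ofNat]
  have h1 := hA z e
  have h2 := hB z e
  rw [← hD] at h1 h2
  calc 2 * ‖(D * inner ℝ (P.eval z) ((derivative P).eval z * e) -
        k * inner ℝ z e * ‖P.eval z‖ ^ 2) +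
        (D * inner ℝ (Q.eval z) ((derivative Q).eval z * e) -
        k * inner ℝ z e * ‖Q.eval z‖ ^ 2)‖ ≤ 2 * (A * D ^ k * ‖e‖ + B * D ^ k * ‖e‖) := by
        gcongr
        exact (norm_add_le _ _).trans (add_le_add h1 h2)
    _ = 2 * (A + B) / M * (M * D ^ k) * ‖e‖ := by field_simp
    _ ≤ 2 * (A + B) / M * sumSq P Q z * ‖e‖ := by
        gcongr
        exact h z
    _ = _ := by field_simp

theorem integrable_one_div_sq : Integrable fun z : ℂ => 1 / (1 + ‖z‖ ^ 2) ^ 2 := by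
  have h := integrable_rpow_neg_one_add_norm_sq (E := ℂ) (μ := volume) (r := 4)
    (by rw [Complex.finrank_real_complex]; norm_num)
  refine h.congr (.of_forall fun z => ?_)
  simp only
  rw [show (-4 / 2 : ℝ) = -((2 : ℕ) : ℝ) by norm_num, Real.rpow_neg (by positivity),
    Real.rpow_natCast, one_div]

theorem continuous_sumSq (P Q : ℂ[X]) : Continuous (sumSq P Q) :=
  ((P.continuous.norm).pow 2).add ((Q.continuous.norm).pow 2)

theorem integrable_wronskian {k : ℕ} {P Q : ℂ[X]} {M : ℝ} (hk : 0 < k) (hP : P.natDegree ≤ k)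
    (hQ : Q.natDegree ≤ k) (hM : 0 < M) (h : ∀ z, M * (1 + ‖z‖ ^ 2) ^ k ≤ sumSq P Q z) :
    Integrable fun z => ‖(wronskian P Q).eval z‖ ^ 2 / sumSq P Q z ^ 2 := by
  have hpos : ∀ z, 0 < sumSq P Q z := fun z => lt_of_lt_of_le (by positivity) (h z)
  obtain ⟨A, hA0, hA⟩ := sq_norm_eval_le (natDegree_wronskian_le hP hQ)
  refine (integrable_one_div_sq.const_mul (A / M ^ 2)).mono' ?_ (.of_forall fun z => ?_)
  · refine Continuous.aestronglyMeasurable ?_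
    exact (((wronskian P Q).continuous.norm).pow 2).div ((continuous_sumSq P Q).pow 2)
      fun z => (pow_pos (hpos z) 2).ne'
  · rw [Real.norm_of_nonneg (by positivity)]
    calc ‖(wronskian P Q).eval z‖ ^ 2 / sumSq P Q z ^ 2
        ≤ A * (1 + ‖z‖ ^ 2) ^ (2 * k - 2) / (M * (1 + ‖z‖ ^ 2) ^ k) ^ 2 := by
          gcongr
          · exact hA z
          · exact h z
      _ = _ := by
          rw [mul_pow, ← pow_mul, mul_comm k 2]
          obtain ⟨l, hl⟩ : ∃ l, 2 * k = l + 2 := ⟨2 * k - 2, by omega⟩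
          rw [hl, Nat.add_sub_cancel, pow_add]
          field_simp

/-- The total curvature of the pullback metric: the map `P / Q` has degree `k`. -/
theorem integral_wronskian {k : ℕ} {P Q : ℂ[X]} {M : ℝ} (hk : 0 < k) (hP : P.natDegree ≤ k)
    (hQ : Q.natDegree ≤ k) (hM : 0 < M) (h : ∀ z, M * (1 + ‖z‖ ^ 2) ^ k ≤ sumSq P Q z) :
    ∫ z, ‖(wronskian P Q).eval z‖ ^ 2 / sumSq P Q z ^ 2 =
      k * ∫ z : ℂ, 1 / (1 + ‖z‖ ^ 2) ^ 2 := by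
  have hpos : ∀ z, 0 < sumSq P Q z := fun z => lt_of_lt_of_le (by positivity) (h z)
  obtain ⟨C, hC⟩ := norm_fderiv_logRatio_le hk hP hQ hM h
  have hi := integrable_wronskian hk hP hQ hM h
  have hj := integrable_one_div_sq.const_mul (k : ℝ)
  have e : Laplacian.laplacian (logRatio k P Q) = fun z =>
      4 * (‖(wronskian P Q).eval z‖ ^ 2 / sumSq P Q z ^ 2 - k * (1 / (1 + ‖z‖ ^ 2) ^ 2)) := by
    ext z
    rw [← laplacian_logRatio hpos z]; ring
  have h0 := integral_laplacian_eq_zero (contDiff_logRatio hpos) hC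
    (e ▸ (hi.sub hj).const_mul 4)
  rw [e, integral_const_mul, integral_sub hi hj, integral_const_mul] at h0
  linarith

theorem integral_one_div_sq_pos : 0 < ∫ z : ℂ, 1 / (1 + ‖z‖ ^ 2) ^ 2 := by
  have hc : Continuous fun z : ℂ => 1 / (1 + ‖z‖ ^ 2) ^ 2 :=
    continuous_const.div (by fun_prop) fun z => by positivity
  exact integral_pos_of_integrable_nonneg_nonzero (x := 0) hc integrable_one_div_sq
    (fun z => by positivity) (by norm_num)

/-! ### Binary forms, Jacobians and their factorization -/

theorem derivative_aeval_mvPolynomial (p : MvPolynomial (Fin 2) ℂ) (f : Fin 2 → ℂ[X]) :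
    derivative (MvPolynomial.aeval f p) =
      MvPolynomial.aeval f (MvPolynomial.pderiv 0 p) * derivative (f 0) +
        MvPolynomial.aeval f (MvPolynomial.pderiv 1 p) * derivative (f 1) := by
  induction p using MvPolynomial.induction_on with
  | C a => simp
  | add p q hp hq => simp only [map_add, hp, hq]; ring
  | mul_X p i hp =>
    fin_cases i <;> simp [Derivation.leibniz, hp, MvPolynomial.pderiv_X] <;> ring

theorem eval_aeval_mvPolynomial (p : MvPolynomial (Fin 2) ℂ) (f : Fin 2 → ℂ[X]) (z : ℂ) :
    (MvPolynomial.aeval f p).eval z = MvPolynomial.eval (fun i => (f i).eval z) p := by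
  induction p using MvPolynomial.induction_on with
  | C a => simp
  | add p q hp hq => simp [hp, hq]
  | mul_X p i hp => simp [hp]

/-- The Jacobian determinant of a pair of forms. -/
noncomputable def jacobian (p q : MvPolynomial (Fin 2) ℂ) : MvPolynomial (Fin 2) ℂ :=
  MvPolynomial.pderiv 0 p * MvPolynomial.pderiv 1 q -
    MvPolynomial.pderiv 1 p * MvPolynomial.pderiv 0 q

theorem isHomogeneous_jacobian {p q : MvPolynomial (Fin 2) ℂ} {k : ℕ} (hp : p.IsHomogeneous k)
    (hq : q.IsHomogeneous k) : (jacobian p q).IsHomogeneous (2 * k - 2) := by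
  have e : 2 * k - 2 = k - 1 + (k - 1) := by omega
  rw [e]
  exact (hp.pderiv.mul hq.pderiv).sub (hp.pderiv.mul hq.pderiv)

/-- Euler's identity writes `k p` and `k q` through the partial derivatives; the terms containing
`X` then cancel. -/
theorem mul_wronskian_chartZ {p q : MvPolynomial (Fin 2) ℂ} {k : ℕ} (hp : p.IsHomogeneous k)
    (hq : q.IsHomogeneous k) :
    (k : ℂ[X]) * wronskian (MvPolynomial.aeval ![X, 1] p) (MvPolynomial.aeval ![X, 1] q) =
      - MvPolynomial.aeval ![X, 1] (jacobian p q) := by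
  have h1 := congrArg (MvPolynomial.aeval ![(X : ℂ[X]), 1]) hp.sum_X_mul_pderiv
  have h2 := congrArg (MvPolynomial.aeval ![(X : ℂ[X]), 1]) hq.sum_X_mul_pderiv
  simp only [Fin.sum_univ_two, map_add, map_mul, map_natCast, MvPolynomial.aeval_X,
    Matrix.cons_val_zero, Matrix.cons_val_one, nsmul_eq_mul] at h1 h2
  simp only [wronskian, derivative_aeval_mvPolynomial, jacobian, map_sub, map_mul,
    Matrix.cons_val_zero, Matrix.cons_val_one, derivative_X, derivative_one]
  linear_combination (-MvPolynomial.aeval ![(X : ℂ[X]), 1] (MvPolynomial.pderiv 0 q)) * h1 +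
    MvPolynomial.aeval ![(X : ℂ[X]), 1] (MvPolynomial.pderiv 0 p) * h2

theorem mul_wronskian_chartW {p q : MvPolynomial (Fin 2) ℂ} {k : ℕ} (hp : p.IsHomogeneous k)
    (hq : q.IsHomogeneous k) :
    (k : ℂ[X]) * wronskian (MvPolynomial.aeval ![1, X] p) (MvPolynomial.aeval ![1, X] q) =
      MvPolynomial.aeval ![1, X] (jacobian p q) := by
  have h1 := congrArg (MvPolynomial.aeval ![1, (X : ℂ[X])]) hp.sum_X_mul_pderiv
  have h2 := congrArg (MvPolynomial.aeval ![1, (X : ℂ[X])]) hq.sum_X_mul_pderiv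
  simp only [Fin.sum_univ_two, map_add, map_mul, map_natCast, MvPolynomial.aeval_X,
    Matrix.cons_val_zero, Matrix.cons_val_one, nsmul_eq_mul] at h1 h2
  simp only [wronskian, derivative_aeval_mvPolynomial, jacobian, map_sub, map_mul,
    Matrix.cons_val_zero, Matrix.cons_val_one, derivative_X, derivative_one]
  linear_combination (-MvPolynomial.aeval ![1, (X : ℂ[X])] (MvPolynomial.pderiv 1 q)) * h1 +
    MvPolynomial.aeval ![1, (X : ℂ[X])] (MvPolynomial.pderiv 1 p) * h2

theorem eval_smul_of_isHomogeneous {p : MvPolynomial (Fin 2) ℂ} {k : ℕ} (hp : p.IsHomogeneous k)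
    (a : ℂ) (u : Fin 2 → ℂ) : MvPolynomial.eval (a • u) p = a ^ k * MvPolynomial.eval u p := by
  rw [MvPolynomial.eval_eq', MvPolynomial.eval_eq', mul_sum]
  refine sum_congr rfl fun d hd => ?_
  have hk : d.weight 1 = k := hp (by simpa using hd)
  simp only [Finsupp.weight_apply, Finsupp.sum_fintype, Fin.sum_univ_two, Pi.one_apply,
    smul_eq_mul, mul_one, implies_true] at hk
  simp only [Fin.prod_univ_two, Pi.smul_apply, smul_eq_mul, ← hk, mul_pow, pow_add]
  ring

theorem eq_C_mul_prod_roots {W : ℂ[X]} (hs : W.Separable) :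
    W = C W.leadingCoeff * ∏ b ∈ W.roots.toFinset, (X - C b) := by
  have h := (IsAlgClosed.splits W).eq_prod_roots
  conv_lhs => rw [h]
  rw [Finset.prod, Multiset.toFinset_val, (nodup_roots hs).dedup]

theorem card_roots_toFinset {W : ℂ[X]} (hs : W.Separable) :
    W.roots.toFinset.card = W.natDegree := by
  rw [Multiset.toFinset_card_of_nodup (nodup_roots hs),
    (IsAlgClosed.splits W).natDegree_eq_card_roots]

theorem eval_homogenize_separable {W : ℂ[X]} (hs : W.Separable) (u : Fin 2 → ℂ) :
    MvPolynomial.eval u (W.homogenize W.natDegree) =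
      W.leadingCoeff * ∏ b ∈ W.roots.toFinset, (u 0 - b * u 1) := by
  have h : W.homogenize W.natDegree = MvPolynomial.C W.leadingCoeff *
      ∏ b ∈ W.roots.toFinset, (MvPolynomial.X 0 - MvPolynomial.C b * MvPolynomial.X 1) := by
    conv_lhs => rw [eq_C_mul_prod_roots hs, homogenize_C_mul, ← eq_C_mul_prod_roots hs]
    rw [← card_roots_toFinset hs, card_eq_sum_ones, homogenize_finsetProd fun b _ => by simp]
    simp
  simp [h]

/-- The squared length of a vector of `ℂ²`. -/
noncomputable def lenSq (u : Fin 2 → ℂ) : ℝ := ‖u 0‖ ^ 2 + ‖u 1‖ ^ 2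

theorem lenSq_pos {u : Fin 2 → ℂ} (hu : u ≠ 0) : 0 < lenSq u := by
  have : u 0 ≠ 0 ∨ u 1 ≠ 0 := by
    by_contra! h
    exact hu (by ext i; fin_cases i <;> simp [h.1, h.2])
  unfold lenSq
  rcases this with h | h <;> positivity

theorem sq_norm_eval_jacobian {P Q : ℂ[X]} {k : ℕ} (hP : P.natDegree ≤ k) (hQ : Q.natDegree ≤ k)
    (hd : (wronskian P Q).natDegree = 2 * k - 2) (hs : (wronskian P Q).Separable)
    (u : Fin 2 → ℂ) :
    ‖MvPolynomial.eval u (jacobian (P.homogenize k) (Q.homogenize k))‖ ^ 2 =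
      k ^ 2 * ‖(wronskian P Q).leadingCoeff‖ ^ 2 *
        ∏ b ∈ (wronskian P Q).roots.toFinset, ‖u 0 - b * u 1‖ ^ 2 := by
  have hp := isHomogeneous_homogenize (n := k) P
  have hq := isHomogeneous_homogenize (n := k) Q
  have h1 := mul_wronskian_chartZ hp hq
  rw [aeval_homogenize_X_one P hP, aeval_homogenize_X_one Q hQ] at h1
  have h2 : jacobian (P.homogenize k) (Q.homogenize k) =
      (C (-(k : ℂ)) * wronskian P Q).homogenize (2 * k - 2) := by
    -- A form of known degree is determined by its restriction to the affine chart.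
    refine (homogenize_eq_of_isHomogeneous (isHomogeneous_jacobian hp hq) ?_).symm
    rw [eq_comm, C_neg, map_natCast, neg_mul, h1, neg_neg]
  rw [h2, homogenize_C_mul, ← hd, map_mul, eval_homogenize_separable hs]
  simp [mul_pow, norm_prod, prod_pow, mul_assoc]

/-! ### Passage to the projective line -/

theorem chartZ_injective : Function.Injective chartZ := by
  intro a b h
  obtain ⟨c, hc⟩ := (Projectivization.mk_eq_mk_iff' ℂ _ _ _ _).1 h
  have h0 := congrFun hc 0
  have h1 := congrFun hc 1
  simp at h0 h1
  rw [← h0, h1, one_mul]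

/-- The affine coordinate as an embedding. -/
noncomputable def chartZEmbedding : ℂ ↪ CP1 := ⟨chartZ, chartZ_injective⟩

theorem chordProd_map_chartZ (R : Finset ℂ) (u : Fin 2 → ℂ) (hu : u ≠ 0) :
    chordProd (R.map chartZEmbedding) (Projectivization.mk ℂ u hu) =
      (∏ b ∈ R, ‖u 0 - b * u 1‖ ^ 2) / (lenSq u ^ R.card * ∏ b ∈ R, (1 + ‖b‖ ^ 2)) := by
  unfold chordProd
  rw [prod_map, ← prod_const, ← prod_mul_distrib, ← prod_div_distrib]
  refine prod_congr rfl fun b _ => ?_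
  rw [chartZEmbedding, Function.Embedding.coeFn_mk, chartZ, chordSq_mk]
  simp [chordSqAux, lenSq, add_comm, mul_comm]

/-- The function `|p|² + |q|²` on `ℂ²`. -/
noncomputable def hermSq (p q : MvPolynomial (Fin 2) ℂ) (u : Fin 2 → ℂ) : ℝ :=
  ‖MvPolynomial.eval u p‖ ^ 2 + ‖MvPolynomial.eval u q‖ ^ 2

theorem hermSq_homogenize {P Q : ℂ[X]} {k : ℕ} (hP : P.natDegree ≤ k) (hQ : Q.natDegree ≤ k)
    {u : Fin 2 → ℂ} (hu : u 1 ≠ 0) :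
    hermSq (P.homogenize k) (Q.homogenize k) u = sumSq P Q (u 0 / u 1) * (‖u 1‖ ^ 2) ^ k := by
  simp only [hermSq, sumSq, eval_homogenize hP u hu, eval_homogenize hQ u hu, norm_mul, norm_pow,
    mul_pow]
  ring

theorem lenSq_eq {u : Fin 2 → ℂ} (hu : u 1 ≠ 0) :
    lenSq u = (1 + ‖u 0 / u 1‖ ^ 2) * ‖u 1‖ ^ 2 := by
  have : ‖u 1‖ ≠ 0 := norm_ne_zero_iff.2 hu
  rw [lenSq, norm_div]
  field_simp
  ring

theorem continuous_hermSq (p q : MvPolynomial (Fin 2) ℂ) : Continuous (hermSq p q) :=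
  (p.continuous_eval.norm.pow 2).add (q.continuous_eval.norm.pow 2)

theorem continuous_lenSq : Continuous lenSq :=
  ((continuous_apply 0).norm.pow 2).add ((continuous_apply 1).norm.pow 2)

/-- Density of `u 1 ≠ 0` on each slice with `u 0` fixed. This carries the affine estimates over to
the point at infinity. -/
theorem le_of_forall_ne_zero {f g : (Fin 2 → ℂ) → ℝ} (hf : Continuous f) (hg : Continuous g)
    (h : ∀ u : Fin 2 → ℂ, u 1 ≠ 0 → f u ≤ g u) (u : Fin 2 → ℂ) : f u ≤ g u := by
  let γ : ℂ → Fin 2 → ℂ := fun s => ![u 0, s]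
  have hγ : Continuous γ := by
    refine continuous_pi fun i => ?_
    fin_cases i
    · exact continuous_const
    · exact continuous_id
  have hc : IsClosed {s : ℂ | f (γ s) ≤ g (γ s)} := isClosed_le (hf.comp hγ) (hg.comp hγ)
  have hu : u = γ (u 1) := by ext i; fin_cases i <;> rfl
  have : u 1 ∈ closure ({0}ᶜ : Set ℂ) := dense_compl_singleton 0 _
  rw [hu]
  exact closure_minimal (fun s hs => h (γ s) hs) hc this

theorem hermSq_bounds {P Q : ℂ[X]} {k : ℕ} {M₁ M₂ : ℝ} (hP : P.natDegree ≤ k)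
    (hQ : Q.natDegree ≤ k) (h : ∀ z, M₁ * (1 + ‖z‖ ^ 2) ^ k ≤ sumSq P Q z ∧
      sumSq P Q z ≤ M₂ * (1 + ‖z‖ ^ 2) ^ k) (u : Fin 2 → ℂ) :
    M₁ * lenSq u ^ k ≤ hermSq (P.homogenize k) (Q.homogenize k) u ∧
      hermSq (P.homogenize k) (Q.homogenize k) u ≤ M₂ * lenSq u ^ k := by
  constructor
  · refine le_of_forall_ne_zero (f := fun u => M₁ * lenSq u ^ k)
      (continuous_const.mul (continuous_lenSq.pow k))
      (continuous_hermSq _ _) (fun u hu => ?_) u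
    rw [hermSq_homogenize hP hQ hu, lenSq_eq hu, mul_pow, ← mul_assoc]
    exact mul_le_mul_of_nonneg_right (h _).1 (by positivity)
  · refine le_of_forall_ne_zero (g := fun u => M₂ * lenSq u ^ k) (continuous_hermSq _ _)
      (continuous_const.mul (continuous_lenSq.pow k)) (fun u hu => ?_) u
    rw [hermSq_homogenize hP hQ hu, lenSq_eq hu, mul_pow, ← mul_assoc]
    exact mul_le_mul_of_nonneg_right (h _).2 (by positivity)

/-- The logarithm of `(|p|² + |q|²) / |u|²ᵏ` on `ℂℙ¹`. -/
noncomputable def logRatioProj (k : ℕ) (p q : MvPolynomial (Fin 2) ℂ) (x : CP1) : ℝ :=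
  Real.log (hermSq p q x.rep) - k * Real.log (lenSq x.rep)

theorem logRatioProj_mk {p q : MvPolynomial (Fin 2) ℂ} {k : ℕ} (hp : p.IsHomogeneous k)
    (hq : q.IsHomogeneous k) {u : Fin 2 → ℂ} (hu : u ≠ 0) (h : 0 < hermSq p q u) :
    logRatioProj k p q (Projectivization.mk ℂ u hu) =
      Real.log (hermSq p q u) - k * Real.log (lenSq u) := by
  obtain ⟨a, ha⟩ := Projectivization.exists_smul_eq_mk_rep ℂ u hu
  have ha0 : 0 < ‖(a : ℂ)‖ := norm_pos_iff.2 a.ne_zero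
  have h1 : hermSq p q (a • u) = (‖(a : ℂ)‖ ^ 2) ^ k * hermSq p q u := by
    simp only [hermSq, Units.smul_def, eval_smul_of_isHomogeneous hp, eval_smul_of_isHomogeneous hq,
      norm_mul, norm_pow, mul_pow]
    ring
  have h2 : lenSq (a • u) = ‖(a : ℂ)‖ ^ 2 * lenSq u := by
    simp only [lenSq, Units.smul_def, Pi.smul_apply, smul_eq_mul, norm_mul, mul_pow]
    ring
  rw [logRatioProj, ← ha, h1, h2, Real.log_mul (by positivity) h.ne',
    Real.log_mul (by positivity) (lenSq_pos hu).ne', Real.log_pow]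
  ring

/-! ### The solution and its bound -/

theorem fsLaplacian_sub_logRatio {k : ℕ} {P Q : ℂ[X]} (h : ∀ z, 0 < sumSq P Q z) (c : ℝ) (z : ℂ) :
    fsLaplacian (fun ζ => c - logRatio k P Q ζ) z =
      k - (1 + ‖z‖ ^ 2) ^ 2 * (‖(wronskian P Q).eval z‖ ^ 2 / sumSq P Q z ^ 2) := by
  have e : (fun ζ => c - logRatio k P Q ζ) = (fun _ => c) - logRatio k P Q := rfl
  have h1 := laplacian_logRatio (k := k) h z
  have h2 : (0 : ℝ) < 1 + ‖z‖ ^ 2 := by positivity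
  rw [fsLaplacian, e, contDiffAt_const.laplacian_sub (contDiff_logRatio h).contDiffAt,
    laplacian_const, Pi.zero_apply, zero_sub, neg_div, h1]
  field_simp
  ring

/-- Replacing `(|P|² + |Q|²)²` by `(1 + |z|²)^(2k)` in `integral_wronskian` controls the average
that normalizes `K`, hence the additive constant of the solution. -/
theorem integral_wronskian_div_bounds {k : ℕ} {P Q : ℂ[X]} {M₁ M₂ : ℝ} (hk : 0 < k)
    (hP : P.natDegree ≤ k) (hQ : Q.natDegree ≤ k) (hM : 0 < M₁)
    (h : ∀ z, M₁ * (1 + ‖z‖ ^ 2) ^ k ≤ sumSq P Q z ∧ sumSq P Q z ≤ M₂ * (1 + ‖z‖ ^ 2) ^ k) :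
    M₁ ^ 2 * (k * ∫ z : ℂ, 1 / (1 + ‖z‖ ^ 2) ^ 2) ≤
        ∫ z, ‖(wronskian P Q).eval z‖ ^ 2 / (1 + ‖z‖ ^ 2) ^ (2 * k) ∧
      ∫ z, ‖(wronskian P Q).eval z‖ ^ 2 / (1 + ‖z‖ ^ 2) ^ (2 * k) ≤
        M₂ ^ 2 * (k * ∫ z : ℂ, 1 / (1 + ‖z‖ ^ 2) ^ 2) := by
  have hpos : ∀ z, 0 < sumSq P Q z := fun z => lt_of_lt_of_le (by positivity) (h z).1
  have hi := integrable_wronskian hk hP hQ hM fun z => (h z).1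
  have hlow : ∀ z, M₁ ^ 2 * (‖(wronskian P Q).eval z‖ ^ 2 / sumSq P Q z ^ 2) ≤
      ‖(wronskian P Q).eval z‖ ^ 2 / (1 + ‖z‖ ^ 2) ^ (2 * k) := fun z => by
    have hz := hpos z
    rw [mul_div_left_comm]
    rw [div_eq_mul_inv]
    refine mul_le_mul_of_nonneg_left ?_ (by positivity)
    rw [← div_eq_mul_inv, div_le_iff₀ (by positivity), ← div_eq_inv_mul, le_div_iff₀ (by positivity),
      mul_comm 2 k, pow_mul, ← mul_pow]
    exact pow_le_pow_left₀ (by positivity) (h z).1 2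
  have hup : ∀ z, ‖(wronskian P Q).eval z‖ ^ 2 / (1 + ‖z‖ ^ 2) ^ (2 * k) ≤
      M₂ ^ 2 * (‖(wronskian P Q).eval z‖ ^ 2 / sumSq P Q z ^ 2) := fun z => by
    have hz := hpos z
    rw [mul_div_left_comm]
    rw [div_eq_mul_inv]
    refine mul_le_mul_of_nonneg_left ?_ (by positivity)
    rw [le_div_iff₀ (by positivity), ← div_eq_inv_mul, div_le_iff₀ (by positivity),
      mul_comm 2 k, pow_mul, ← mul_pow]
    exact pow_le_pow_left₀ hz.le (h z).2 2
  have hd : Integrable fun z => ‖(wronskian P Q).eval z‖ ^ 2 / (1 + ‖z‖ ^ 2) ^ (2 * k) := by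
    refine (hi.const_mul (M₂ ^ 2)).mono' (Continuous.aestronglyMeasurable ?_)
      (.of_forall fun z => ?_)
    · exact (((wronskian P Q).continuous.norm).pow 2).div (by fun_prop) fun z => by positivity
    · rw [Real.norm_of_nonneg (by positivity)]
      exact hup z
  rw [← integral_wronskian hk hP hQ hM fun z => (h z).1, ← integral_const_mul,
    ← integral_const_mul]
  exact ⟨integral_mono (hi.const_mul _) hd hlow, integral_mono hd (hi.const_mul _) hup⟩

theorem isBranchSet_roots {P Q : ℂ[X]} {k : ℕ} {M₁ M₂ : ℝ} (hk : 0 < k) (hP : P.natDegree ≤ k)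
    (hQ : Q.natDegree ≤ k) (hd : (wronskian P Q).natDegree = 2 * k - 2)
    (hs : (wronskian P Q).Separable) (hM : 0 < M₁)
    (h : ∀ z, M₁ * (1 + ‖z‖ ^ 2) ^ k ≤ sumSq P Q z ∧ sumSq P Q z ≤ M₂ * (1 + ‖z‖ ^ 2) ^ k) :
    IsBranchSet k ((wronskian P Q).roots.toFinset.map chartZEmbedding) := by
  refine ⟨P.homogenize k, Q.homogenize k, isHomogeneous_homogenize P, isHomogeneous_homogenize Q,
    fun u hu => ?_, fun u hu => ?_⟩
  · by_contra! h0
    have h1 := (hermSq_bounds hP hQ h u).1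
    have h2 : 0 < M₁ * lenSq u ^ k := mul_pos hM (pow_pos (lenSq_pos hu) k)
    simp [hermSq, h0.1, h0.2] at h1
    linarith
  · have hJ := sq_norm_eval_jacobian hP hQ hd hs u
    have hW : (wronskian P Q).leadingCoeff ≠ 0 := leadingCoeff_ne_zero.2 hs.ne_zero
    change _ ↔ MvPolynomial.eval u (jacobian (P.homogenize k) (Q.homogenize k)) = 0
    rw [← norm_eq_zero, ← sq_eq_zero_iff, hJ]
    have hne : (k : ℝ) ^ 2 * ‖(wronskian P Q).leadingCoeff‖ ^ 2 ≠ 0 := by positivity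
    rw [mul_eq_zero, or_iff_right hne, prod_eq_zero_iff, Finset.mem_map]
    refine exists_congr fun b => and_congr_right fun _ => ?_
    rw [sq_eq_zero_iff, norm_eq_zero, sub_eq_zero, eq_comm]
    change Projectivization.mk ℂ u hu = Projectivization.mk ℂ ![b, 1] _ ↔ _
    rw [Projectivization.mk_eq_mk_iff']
    constructor
    · rintro ⟨a, rfl⟩
      simp [mul_comm]
    · intro hb
      exact ⟨u 1, by ext i; fin_cases i <;> simp [hb, mul_comm]⟩

/-- If `|P|² + |Q|²` is comparable to `(1 + |z|²)ᵏ`, its logarithm yields a bounded solution. -/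
theorem exists_bounded_solution {P Q : ℂ[X]} {k : ℕ} {M₁ M₂ : ℝ} (hk : 0 < k)
    (hP : P.natDegree ≤ k) (hQ : Q.natDegree ≤ k)
    (hd : (wronskian P Q).natDegree = 2 * k - 2) (hs : (wronskian P Q).Separable) (hM : 0 < M₁)
    (h : ∀ z, M₁ * (1 + ‖z‖ ^ 2) ^ k ≤ sumSq P Q z ∧ sumSq P Q z ≤ M₂ * (1 + ‖z‖ ^ 2) ^ k) :
    ∃ v : CP1 → ℝ, IsSolution k
        (curvatureFn k ((wronskian P Q).roots.toFinset.map chartZEmbedding)) v ∧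
      ∀ x, |v x| ≤ Real.log M₂ - Real.log M₁ +
        |Real.log ((∫ z : ℂ, 1 / (1 + ‖z‖ ^ 2) ^ 2) / Real.pi) / 2| := by
  set I := ∫ z : ℂ, 1 / (1 + ‖z‖ ^ 2) ^ 2 with hI
  have hI0 : 0 < I := integral_one_div_sq_pos
  set W := wronskian P Q with hW
  set B := W.roots.toFinset.map chartZEmbedding with hB
  set p := P.homogenize k with hp_def
  set q := Q.homogenize k with hq_def
  have hp : p.IsHomogeneous k := isHomogeneous_homogenize P
  have hq : q.IsHomogeneous k := isHomogeneous_homogenize Q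
  have hk0 : (0 : ℝ) < k := by exact_mod_cast hk
  have hM₂ : 0 < M₂ := by
    have h0 := (h 0).1.trans (h 0).2
    simp at h0
    linarith
  have hpos : ∀ u : Fin 2 → ℂ, u ≠ 0 → 0 < hermSq p q u := fun u hu =>
    lt_of_lt_of_le (mul_pos hM (pow_pos (lenSq_pos hu) k)) (hermSq_bounds hP hQ h u).1
  set E : ℝ := ∏ b ∈ W.roots.toFinset, (1 + ‖b‖ ^ 2)
  have hE : 0 < E := prod_pos fun b _ => by positivity
  have hl : 0 < ‖W.leadingCoeff‖ := norm_pos_iff.2 (leadingCoeff_ne_zero.2 hs.ne_zero)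
  set G : ℝ := 1 / (k ^ 2 * ‖W.leadingCoeff‖ ^ 2 * E) with hG_def
  have hG : 0 < G := by positivity
  have hchord : ∀ (u : Fin 2 → ℂ) (hu : u ≠ 0), chordProd B (Projectivization.mk ℂ u hu) =
      G * ‖MvPolynomial.eval u (jacobian p q)‖ ^ 2 / lenSq u ^ (2 * k - 2) := by
    intro u hu
    have := lenSq_pos hu
    have h1 := sq_norm_eval_jacobian hP hQ hd hs u
    have h2 := chordProd_map_chartZ W.roots.toFinset u hu
    rw [← hW, ← hp_def, ← hq_def] at h1
    rw [card_roots_toFinset hs, hd, ← hB] at h2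
    change _ = _ / (_ * E) at h2
    rw [h1, h2, hG_def]
    generalize ∏ b ∈ W.roots.toFinset, ‖u 0 - b * u 1‖ ^ 2 = T
    field_simp
  have hz0 : ∀ z : ℂ, ![z, 1] ≠ 0 := fun z h => one_ne_zero (congrFun h 1)
  have hw0 : ∀ w : ℂ, ![1, w] ≠ 0 := fun w h => one_ne_zero (congrFun h 0)
  have hlz : ∀ z : ℂ, lenSq ![z, 1] = 1 + ‖z‖ ^ 2 := fun z => by simp [lenSq, add_comm]
  have hlw : ∀ w : ℂ, lenSq ![1, w] = 1 + ‖w‖ ^ 2 := fun w => by simp [lenSq]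
  have evz : ∀ (r : MvPolynomial (Fin 2) ℂ) (z : ℂ),
      (MvPolynomial.aeval ![X, 1] r).eval z = MvPolynomial.eval ![z, 1] r := fun r z => by
    rw [eval_aeval_mvPolynomial]
    congr 2
    ext i; fin_cases i <;> simp
  have evw : ∀ (r : MvPolynomial (Fin 2) ℂ) (w : ℂ),
      (MvPolynomial.aeval ![1, X] r).eval w = MvPolynomial.eval ![1, w] r := fun r w => by
    rw [eval_aeval_mvPolynomial]
    congr 2
    ext i; fin_cases i <;> simp
  have hAP : MvPolynomial.aeval ![X, 1] p = P := aeval_homogenize_X_one P hP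
  have hAQ : MvPolynomial.aeval ![X, 1] q = Q := aeval_homogenize_X_one Q hQ
  set P' : ℂ[X] := MvPolynomial.aeval ![1, X] p
  set Q' : ℂ[X] := MvPolynomial.aeval ![1, X] q
  have hsz : ∀ z, sumSq P Q z = hermSq p q ![z, 1] := fun z => by
    rw [hermSq, ← evz, ← evz, hAP, hAQ, sumSq]
  have hsw : ∀ w, sumSq P' Q' w = hermSq p q ![1, w] := fun w => by
    rw [hermSq, ← evw, ← evw, sumSq]
  have hJz : ∀ z, ‖MvPolynomial.eval ![z, 1] (jacobian p q)‖ ^ 2 = k ^ 2 * ‖W.eval z‖ ^ 2 := by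
    intro z
    have h1 := congrArg (fun r : ℂ[X] => ‖r.eval z‖ ^ 2) (mul_wronskian_chartZ hp hq)
    simpa [hAP, hAQ, evz, mul_pow, hW] using h1.symm
  have hJw : ∀ w, ‖MvPolynomial.eval ![1, w] (jacobian p q)‖ ^ 2 =
      k ^ 2 * ‖(wronskian P' Q').eval w‖ ^ 2 := by
    intro w
    have h1 := congrArg (fun r : ℂ[X] => ‖r.eval w‖ ^ 2) (mul_wronskian_chartW hp hq)
    simpa [evw, mul_pow] using h1.symm
  set a := average (chordProd B) with ha_def
  have ha : a = G * k ^ 2 * (∫ z, ‖W.eval z‖ ^ 2 / (1 + ‖z‖ ^ 2) ^ (2 * k)) / Real.pi := by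
    rw [ha_def, average, ← integral_const_mul]
    congr 2
    ext z
    rw [chartZ, hchord, hJz, hlz]
    obtain ⟨l, hl⟩ : ∃ l, 2 * k = l + 2 := ⟨2 * k - 2, by omega⟩
    rw [hl, Nat.add_sub_cancel, pow_add]
    field_simp
  obtain ⟨hD1, hD2⟩ := integral_wronskian_div_bounds hk hP hQ hM h
  rw [← hI, ← hW] at hD1 hD2
  set D := ∫ z, ‖W.eval z‖ ^ 2 / (1 + ‖z‖ ^ 2) ^ (2 * k)
  have hD0 : 0 < D := lt_of_lt_of_le (by positivity) hD1
  have ha0 : 0 < a := by rw [ha]; positivity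
  -- The factor `k³ G / a` collects `k / a` from the normalization, `G` from the chordal product and
  -- `k²` from the Jacobian. In `e^(2c)` the constant `G` cancels against `a`, leaving `D / (k π)`,
  -- which is bounded independently of `k`.
  set c := Real.log (a / (k ^ 3 * G)) / 2 with hc_def
  have hc : Real.exp (2 * c) = a / (k ^ 3 * G) := by
    rw [hc_def, mul_div_cancel₀ _ two_ne_zero, Real.exp_log (by positivity)]
  have hak : a / (k ^ 3 * G) = D / (k * I) * (I / Real.pi) := by
    rw [ha]; field_simp
  have hcb : Real.log M₁ + Real.log (I / Real.pi) / 2 ≤ c ∧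
      c ≤ Real.log M₂ + Real.log (I / Real.pi) / 2 := by
    have e : c = (Real.log (D / (k * I)) + Real.log (I / Real.pi)) / 2 := by
      rw [hc_def, hak, Real.log_mul (by positivity) (by positivity)]
    have h1 : Real.log (M₁ ^ 2) ≤ Real.log (D / (k * I)) :=
      Real.log_le_log (by positivity) ((le_div_iff₀ (by positivity)).2 hD1)
    have h2 : Real.log (D / (k * I)) ≤ Real.log (M₂ ^ 2) :=
      Real.log_le_log (by positivity) ((div_le_iff₀ (by positivity)).2 hD2)
    rw [Real.log_pow] at h1 h2
    push_cast at h1 h2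
    constructor <;> rw [e] <;> linarith
  have hK : ∀ (u : Fin 2 → ℂ) (hu : u ≠ 0) (S : ℝ),
      ‖MvPolynomial.eval u (jacobian p q)‖ ^ 2 = k ^ 2 * S →
      curvatureFn k B (Projectivization.mk ℂ u hu) *
        Real.exp (2 * (c - logRatioProj k p q (Projectivization.mk ℂ u hu))) =
      lenSq u ^ 2 * (S / hermSq p q u ^ 2) := by
    intro u hu S hS
    have h1 := hpos u hu
    have h2 := lenSq_pos hu
    have e : Real.exp (2 * (c - logRatioProj k p q (Projectivization.mk ℂ u hu))) =
        a / (k ^ 3 * G) * (lenSq u ^ (2 * k) / hermSq p q u ^ 2) := by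
      rw [logRatioProj_mk hp hq hu h1, mul_sub, sub_eq_add_neg, Real.exp_add, hc]
      congr 1
      rw [← Real.exp_log (show 0 < lenSq u ^ (2 * k) / hermSq p q u ^ 2 by positivity),
        Real.log_div (by positivity) (by positivity), Real.log_pow, Real.log_pow]
      congr 1
      push_cast
      ring
    rw [e, curvatureFn, hchord, hS, ← ha_def]
    obtain ⟨l, hl⟩ : ∃ l, 2 * k = l + 2 := ⟨2 * k - 2, by omega⟩
    rw [hl, Nat.add_sub_cancel, pow_add]
    field_simp
  have hvz : (fun z => c - logRatioProj k p q (chartZ z)) = fun z => c - logRatio k P Q z := by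
    ext z
    rw [chartZ, logRatioProj_mk hp hq _ (hpos _ (hz0 z)), logRatio, hsz, hlz, sumSq_one_X]
  have hvw : (fun w => c - logRatioProj k p q (chartW w)) = fun w => c - logRatio k P' Q' w := by
    ext w
    rw [chartW, logRatioProj_mk hp hq _ (hpos _ (hw0 w)), logRatio, hsw, hlw, sumSq_one_X]
  have posz : ∀ z, 0 < sumSq P Q z := fun z => hsz z ▸ hpos _ (hz0 z)
  have posw : ∀ w, 0 < sumSq P' Q' w := fun w => hsw w ▸ hpos _ (hw0 w)
  refine ⟨fun x => c - logRatioProj k p q x, ⟨⟨?_, ?_⟩, fun z => ?_, fun w => ?_⟩, fun x => ?_⟩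
  · rw [hvz]; exact contDiff_const.sub (contDiff_logRatio posz)
  · rw [hvw]; exact contDiff_const.sub (contDiff_logRatio posw)
  · rw [hvz, fsLaplacian_sub_logRatio posz, chartZ, hK _ (hz0 z) _ (hJz z), hlz, hsz]
  · rw [hvw, fsLaplacian_sub_logRatio posw, chartW, hK _ (hw0 w) _ (hJw w), hlw, hsw]
  · have hx := Projectivization.rep_nonzero x
    obtain ⟨h1, h2⟩ := hermSq_bounds hP hQ h x.rep
    have h3 := lenSq_pos hx
    have h1' := Real.log_le_log (by positivity) h1
    have h2' := Real.log_le_log (hpos _ hx) h2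
    rw [Real.log_mul hM.ne' (by positivity), Real.log_pow] at h1'
    rw [Real.log_mul hM₂.ne' (by positivity), Real.log_pow] at h2'
    have h4 := neg_abs_le (Real.log (I / Real.pi) / 2)
    have h5 := le_abs_self (Real.log (I / Real.pi) / 2)
    change |c - (Real.log (hermSq p q x.rep) - k * Real.log (lenSq x.rep))| ≤ _
    rw [abs_le]
    constructor <;> linarith [hcb.1, hcb.2]

end BranchPDE

theorem mainTheorem10 :
    ∃ C : ℝ, ∃ N : ℕ, ∀ k : ℕ, N ≤ k →
      ∃ B : Finset BranchPDE.CP1, B.card + 2 = 2 * k ∧ BranchPDE.IsBranchSet k B ∧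
        ∃ v : BranchPDE.CP1 → ℝ,
          BranchPDE.IsSolution k (BranchPDE.curvatureFn k B) v ∧ ∀ x, |v x| ≤ C := by
  obtain ⟨M₁, M₂, hM, h⟩ := BranchPDE.exists_balanced_pair_separable
  -- The threshold `4` is the least `k` for which the middle gap of the exponents exists.
  refine ⟨Real.log M₂ - Real.log M₁ +
    |Real.log ((∫ z : ℂ, 1 / (1 + ‖z‖ ^ 2) ^ 2) / Real.pi) / 2|, 4, fun k hk => ?_⟩
  obtain ⟨P, Q, hP, hQ, hd, hs, hb⟩ := h k hk
  refine ⟨_, ?_, BranchPDE.isBranchSet_roots (by omega) hP hQ hd hs hM hb,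
    BranchPDE.exists_bounded_solution (by omega) hP hQ hd hs hM hb⟩
  rw [Finset.card_map, BranchPDE.card_roots_toFinset hs, hd]
  omega
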